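/- Let $p,q\ge 0$ be integers, $n=p+q\in\{1,2,3,4\}$, and let $\mathcal{C}\ell_{p,q}$ be the real Clifford algebra with identity $e\equiv 1$ and generators $e_1,\dots,e_n$, $e_ae_b+e_be_a=2\eta_{ab}e$, $\eta=\mathrm{diag}(1,\dots,1,-1,\dots,-1)$ ($p$ ones, $q$ minus ones). Let $\langle U\rangle_k$ denote the projection of $U$ onto the subspace of grade $k$ (the span of the products $e_{a_1}\cdots e_{a_k}$, $a_1<\dots<a_k$); grade $0$ is identified with $\mathbb{R}$. Put $$\hat U=\sum_k(-1)^k\langle U\rangle_k,\qquad \tilde U=\sum_k(-1)^{k(k-1)/2}\langle U\rangle_k,\qquad U^{\vartriangle}=\sum_k(-1)^{\binom{k}{4}}\langle U\rangle_k .$$ Let $N=2^{[(n+1)/2]}$. There are isomorphisms of complex algebras $$\beta:\ \mathbb{C}\otimes\mathcal{C}\ell_{p,q}\to \mathrm{Mat}(2^{n/2},\mathbb{C})\ (n\text{ even}),\qquad \beta:\ \mathbb{C}\otimes\mathcal{C}\ell_{p,q}\to \mathrm{Mat}(2^{(n-1)/2},\mathbb{C})\oplus \mathrm{Mat}(2^{(n-1)/2},\mathbb{C})\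 (n\text{ odd}),$$ and we regard $\beta(U)$, $U\in\mathcal{C}\ell_{p,q}$, as a (block-diagonal if $n$ is odd) complex $N\times N$ matrix. Let $\mathrm{Det}(U)=\det\beta(U)$, and define $C_{(1)},\dots,C_{(N)}$ by $$\det(\lambda I_N-\beta(U))=\lambda^N-C_{(1)}\lambda^{N-1}-\dots-C_{(N-1)}\lambda-C_{(N)}.$$ The adjugate $\mathrm{Adj}(U)\in\mathcal{C}\ell_{p,q}$ is the element with $\beta(\mathrm{Adj}(U))=\mathrm{adj}(\beta(U))$ and $\mathrm{Adj}(U)\,U=U\,\mathrm{Adj}(U)=\mathrm{Det}(U)$. Then for every such $\beta$ and every $U\in\mathcal{C}\ell_{p,q}$ the numbers $\mathrm{Det}(U),C_{(1)},\dots,C_{(N)}$ are real, $\mathrm{Adj}(U)$ exists and is unique, $U$ is invertible if and only if $\mathrm{Det}(U)\ne0$, in which case $U^{-1}=\mathrm{Adj}(U)/\mathrm{Det}(U)$, and the following formulas hold (in particular, the right-hand sides of those for $C_{(k)}$ and $\mathrm{Det}(U)$ have grade $0$). For $n=1$: $$C_{(1)}=U+\hat U,\quad \mathrm{Det}(U)=-C_{(2)}=U\hat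 U,\quad \mathrm{Adj}(U)=\hat U,\quad U^{-1}=\frac{\hat U}{\mathrm{Det}(U)}.$$ For $n=2$: $$C_{(1)}=U+\hat{\tilde U},\quad \mathrm{Det}(U)=-C_{(2)}=U\hat{\tilde U},\quad \mathrm{Adj}(U)=\hat{\tilde U},\quad U^{-1}=\frac{\hat{\tilde U}}{\mathrm{Det}(U)}.$$ For $n=3$: $$C_{(1)}=U+\hat U+\tilde U+\hat{\tilde U},\qquad C_{(2)}=-(U\tilde U+U\hat U+U\hat{\tilde U}+\hat U\hat{\tilde U}+\tilde U\hat{\tilde U}+\hat U\tilde U),$$ $$C_{(3)}=U\hat U\hat{\tilde U}+U\tilde U\hat{\tilde U}+U\hat U\tilde U+\hat U\tilde U\hat{\tilde U},\qquad \mathrm{Det}(U)=-C_{(4)}=U\hat U\tilde U\hat{\tilde U},$$ $$\mathrm{Adj}(U)=\hat U\tilde U\hat{\tilde U},\qquad U^{-1}=\frac{\hat U\tilde U\hat{\tilde U}}{\mathrm{Det}(U)}.$$ For $n=4$: $$C_{(1)}=U+\hat{\tilde U}+\hat U^{\vartriangle}+\tilde U^{\vartriangle},$$ $$C_{(2)}=-(U\hat{\tilde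 U}+U\hat U^{\vartriangle}+U\tilde U^{\vartriangle}+\hat{\tilde U}\hat U^{\vartriangle}+\hat{\tilde U}\tilde U^{\vartriangle}+(\hat U\tilde U)^{\vartriangle}),$$ $$C_{(3)}=U\hat{\tilde U}\hat U^{\vartriangle}+U\hat{\tilde U}\tilde U^{\vartriangle}+U(\hat U\tilde U)^{\vartriangle}+\hat{\tilde U}(\hat U\tilde U)^{\vartriangle},\qquad \mathrm{Det}(U)=-C_{(4)}=U\hat{\tilde U}(\hat U\tilde U)^{\vartriangle},$$ $$\mathrm{Adj}(U)=\hat{\tilde U}(\hat U\tilde U)^{\vartriangle},\qquad U^{-1}=\frac{\hat{\tilde U}(\hat U\tilde U)^{\vartriangle}}{\mathrm{Det}(U)}.$$ -/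

import Mathlib

open scoped TensorProduct Polynomial

namespace GeomAlg

noncomputable section

/-- The quadratic form `x₁² + ⋯ + x_p² - x_{p+1}² - ⋯ - x_{p+q}²`. -/
def sigForm (p q : ℕ) : QuadraticForm ℝ (Fin (p + q) → ℝ) :=
  QuadraticMap.weightedSumSquares ℝ (fun a : Fin (p + q) => if (a : ℕ) < p then (1 : ℝ) else -1)

/-- The real Clifford algebra of signature `(p, q)`. -/
abbrev Cl (p q : ℕ) : Type := CliffordAlgebra (sigForm p q)

/-- The generators `e_a`. -/
def gen {p q : ℕ} (a : Fin (p + q)) : Cl p q := CliffordAlgebra.ι (sigForm p q) (Pi.single a 1)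

/-- `e_{a₁ ⋯ a_k} = e_{a₁} ⋯ e_{a_k}` for `A = {a₁ < ⋯ < a_k}`. -/
def genProd {p q : ℕ} (A : Finset (Fin (p + q))) : Cl p q :=
  (List.ofFn fun i : Fin A.card => (gen (A.orderEmbOfFin rfl i) : Cl p q)).prod

theorem associated_single {p q : ℕ} {a b : Fin (p + q)} (h : a ≠ b) :
    QuadraticMap.associated (R := ℝ) (-(sigForm p q)) (Pi.single a (1 : ℝ)) (Pi.single b (1 : ℝ))
      = 0 := by
  rw [QuadraticMap.associated_apply]
  have key : sigForm p q (Pi.single a 1 + Pi.single b 1)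
      = sigForm p q (Pi.single a 1) + sigForm p q (Pi.single b 1) := by
    simp only [sigForm, QuadraticMap.weightedSumSquares_apply, ← Finset.sum_add_distrib]
    refine Finset.sum_congr rfl fun i _ => ?_
    by_cases hi : i = a
    · subst hi; simp [Pi.single_eq_of_ne h]
    · simp [Pi.single_eq_of_ne hi]
  simp [key]

theorem contractLeft_prod {p q : ℕ} (l : List (Fin (p + q))) (a : Fin (p + q)) (ha : a ∉ l) :
    CliffordAlgebra.contractLeft
      (QuadraticMap.associated (R := ℝ) (-(sigForm p q)) (Pi.single a (1 : ℝ)))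
      (l.map (fun b => CliffordAlgebra.ι (0 : QuadraticForm ℝ (Fin (p + q) → ℝ))
        (Pi.single b (1 : ℝ)))).prod = 0 := by
  induction l with
  | nil => simp
  | cons b l ih =>
    simp only [List.mem_cons, not_or] at ha
    rw [List.map_cons, List.prod_cons, CliffordAlgebra.contractLeft_ι_mul, ih ha.2,
      associated_single ha.1]
    simp

/-- The linear isomorphism with the exterior algebra sends a product of distinct generators
to the wedge product of the corresponding vectors. -/
theorem equivExterior_prod {p q : ℕ} (l : List (Fin (p + q)))
    (hl : l.Nodup) :
    CliffordAlgebra.equivExterior (sigForm p q) (l.map (fun a => (gen a : Cl p q))).prod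
      = (l.map (fun a => ExteriorAlgebra.ι ℝ (Pi.single a (1 : ℝ) : Fin (p + q) → ℝ))).prod := by
  induction l with
  | nil => simp
  | cons b l ih =>
    rw [List.nodup_cons] at hl
    have ih' := ih hl.2
    simp only [CliffordAlgebra.equivExterior, CliffordAlgebra.changeFormEquiv_apply] at ih' ⊢
    rw [List.map_cons, List.prod_cons, gen, CliffordAlgebra.changeForm_ι_mul, ih', List.map_cons,
      List.prod_cons]
    have := contractLeft_prod l b hl.1
    exact sub_eq_self.2 this

/-- The basis `e_A` of the Clifford algebra. -/
def bladeBasis (p q : ℕ) : Module.Basis (Finset (Fin (p + q))) ℝ (Cl p q) :=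
  (Pi.basisFun ℝ (Fin (p + q))).ExteriorAlgebra.map
    (CliffordAlgebra.equivExterior (sigForm p q)).symm

/-- The members of `bladeBasis` are the ordered products of generators. -/
theorem bladeBasis_apply {p q : ℕ} (A : Finset (Fin (p + q))) :
    bladeBasis p q A = genProd A := by
  rw [bladeBasis, Module.Basis.map_apply, LinearEquiv.symm_apply_eq, genProd]
  have h := equivExterior_prod (p := p) (q := q) (List.ofFn fun i => A.orderEmbOfFin rfl i)
    (List.nodup_ofFn.2 (A.orderEmbOfFin rfl).injective)
  rw [List.map_ofFn, List.map_ofFn] at h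
  refine Eq.trans ?_ h.symm
  rw [ExteriorAlgebra.basis_apply_ofCard (n := A.card) _ rfl]
  refine (ExteriorAlgebra.ιMulti_apply _).trans ?_
  simp only [Set.powersetCard.ofFinEmbEquiv_symm_apply, Function.comp_def, Pi.basisFun_apply]
  rfl

/-- The projection `⟨U⟩_k` onto the span of the `e_A` with `|A| = k`. -/
def gradeProj {p q : ℕ} (k : ℕ) (U : Cl p q) : Cl p q :=
  ∑ A ∈ Finset.powersetCard k Finset.univ, (bladeBasis p q).repr U A • bladeBasis p q A

/-- The grade involution `Û`. -/
def hat {p q : ℕ} (U : Cl p q) : Cl p q := CliffordAlgebra.involute U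

/-- The reversion `Ũ`. -/
def tilde {p q : ℕ} (U : Cl p q) : Cl p q := CliffordAlgebra.reverse U

/-- The special conjugations `U ↦ ∑_k (-1)^{binom(k, 2^{j-1})} ⟨U⟩_k`, `j = 1, 2, …`. -/
def specialConj {p q : ℕ} (j : ℕ) (U : Cl p q) : Cl p q :=
  ∑ k ∈ Finset.range (p + q + 1), (-1 : ℝ) ^ (k.choose (2 ^ (j - 1))) • gradeProj k U

/-- The additional conjugation `U^△`. -/
def tri {p q : ℕ} (U : Cl p q) : Cl p q := specialConj 3 U

theorem genProd_eq {p q : ℕ} (A : Finset (Fin (p+q))) : (genProd A : Cl p q) = ((List.ofFn fun i : Fin A.card => (Pi.single (A.orderEmbOfFin rfl i) (1:ℝ) : Fin (p+q) → ℝ)).map (CliffordAlgebra.ι (sigForm p q))).prod := by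
  rw [List.map_ofFn]; rfl

theorem specialConj_eq {p q : ℕ} (j : ℕ) (U : Cl p q) : specialConj j U =
   ∑ A, (bladeBasis p q).repr U A • (-1 : ℝ)^(A.card.choose (2^(j-1))) • bladeBasis p q A := by
  unfold specialConj gradeProj
  rw [← Finset.powerset_univ, Finset.sum_powerset]
  simp only [Finset.card_univ, Fintype.card_fin, Finset.smul_sum]
  refine Finset.sum_congr rfl fun k _ => Finset.sum_congr rfl fun A hA => ?_
  rw [(Finset.mem_powersetCard.1 hA).2, smul_comm]

/-- `Û = ∑_k (-1)^k ⟨U⟩_k`, the first special conjugation. -/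
theorem hat_eq {p q : ℕ} (U : Cl p q) : hat U = specialConj 1 U := by
  rw [specialConj_eq]
  conv_lhs => rw [← (bladeBasis p q).sum_repr U]
  unfold hat
  rw [map_sum]
  refine Finset.sum_congr rfl fun A _ => ?_
  rw [map_smul, bladeBasis_apply, genProd_eq, CliffordAlgebra.involute_prod_map_ι]
  simp

/-- `e_a e_b = -e_b e_a` for `a ≠ b`. -/
theorem gen_mul_gen_of_ne {p q : ℕ} {a b : Fin (p+q)} (h : a ≠ b) : (gen a * gen b : Cl p q) = - (gen b * gen a) := by
  have := associated_single h
  unfold gen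
  rw [eq_neg_iff_add_eq_zero, CliffordAlgebra.ι_mul_ι_add_swap]
  rw [QuadraticMap.associated_apply] at this
  have h2 : QuadraticMap.polar (sigForm p q) (Pi.single a 1) (Pi.single b 1) = 0 := by
    simp at this
    unfold QuadraticMap.polar
    linarith
  rw [h2, map_zero]

/-- `e_a² = η_aa`. -/
theorem gen_mul_self {p q : ℕ} (a : Fin (p+q)) : (gen a * gen a : Cl p q) = algebraMap _ _ (if (a:ℕ) < p then (1:ℝ) else -1) := by
  unfold gen
  rw [CliffordAlgebra.ι_sq_scalar]
  congr 1
  simp [sigForm, QuadraticMap.weightedSumSquares_apply, Pi.single_apply]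

theorem prod_gen_mul_gen {p q : ℕ} (l : List (Fin (p+q))) (a) (h : a ∉ l) : (l.map gen).prod * gen a = (-1:ℝ)^l.length • (gen a * (l.map gen).prod : Cl p q) := by
  induction l with
  | nil => simp
  | cons b l ih =>
    simp only [List.mem_cons, not_or] at h
    rw [List.map_cons, List.prod_cons, mul_assoc, ih h.2, mul_smul_comm, ← mul_assoc, ← mul_assoc, gen_mul_gen_of_ne (Ne.symm h.1)]
    simp [pow_succ]

theorem reverse_prod_gen {p q : ℕ} (l : List (Fin (p+q))) (h : l.Nodup) : CliffordAlgebra.reverse (l.map gen).prod = (-1:ℝ)^(l.length.choose 2) • ((l.map gen).prod : Cl p q) := by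
  induction l with
  | nil => simp
  | cons b l ih =>
    rw [List.nodup_cons] at h
    rw [List.map_cons, List.prod_cons, CliffordAlgebra.reverse.map_mul, ih h.2, smul_mul_assoc]
    rw [show CliffordAlgebra.reverse (gen b : Cl p q) = gen b from CliffordAlgebra.reverse_ι _, prod_gen_mul_gen l b h.1, smul_smul, ← pow_add]
    rw [List.length_cons, Nat.choose_succ_succ' l.length 1]; simp [add_comm]

/-- `Ũ = ∑_k (-1)^{k(k-1)/2} ⟨U⟩_k`, the second special conjugation. -/
theorem tilde_eq {p q : ℕ} (U : Cl p q) : tilde U = specialConj 2 U := by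
  rw [specialConj_eq]
  conv_lhs => rw [← (bladeBasis p q).sum_repr U]
  unfold tilde
  rw [map_sum]
  refine Finset.sum_congr rfl fun A _ => ?_
  have := reverse_prod_gen (p:=p) (q:=q) (List.ofFn fun i => A.orderEmbOfFin rfl i) (List.nodup_ofFn.2 (A.orderEmbOfFin rfl).injective)
  rw [List.map_ofFn] at this
  rw [map_smul, bladeBasis_apply]
  unfold genProd
  congr 1
  refine this.trans ?_
  simp [Function.comp_def]

/-- Representations `β`: complex algebra isomorphisms of the complexified Clifford algebra with
`Mat(2^{n/2}, ℂ)` if `n = p + q` is even (one block), and with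
`Mat(2^{(n-1)/2}, ℂ) ⊕ Mat(2^{(n-1)/2}, ℂ)` if `n` is odd (two blocks). -/
abbrev Rep (p q : ℕ) : Type :=
  (ℂ ⊗[ℝ] Cl p q) ≃ₐ[ℂ]
    (Fin ((p + q) % 2 + 1) → Matrix (Fin (2 ^ ((p + q) / 2))) (Fin (2 ^ ((p + q) / 2))) ℂ)

/-- The (block-diagonal) complex matrix `β(U)` of an element of the real Clifford algebra. -/
def repMatrix {p q : ℕ} (β : Rep p q) (U : Cl p q) :
    Matrix (Fin (2 ^ ((p + q) / 2)) × Fin ((p + q) % 2 + 1))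
      (Fin (2 ^ ((p + q) / 2)) × Fin ((p + q) % 2 + 1)) ℂ :=
  Matrix.blockDiagonal (β ((1 : ℂ) ⊗ₜ[ℝ] U))

/-- `N = 2^{[(n+1)/2]}`, the size of the matrix `β(U)`. -/
def repDim (p q : ℕ) : ℕ := 2 ^ ((p + q + 1) / 2)

/-- `Det(U) = det β(U)`, as a real number. -/
def Det {p q : ℕ} (β : Rep p q) (U : Cl p q) : ℝ := (repMatrix β U).det.re

/-- The coefficients `C_{(k)}`, `1 ≤ k ≤ N`, in
`det(λ I - β(U)) = λ^N - C_{(1)} λ^{N-1} - ⋯ - C_{(N)}`, as real numbers. -/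
def charCoeff {p q : ℕ} (β : Rep p q) (k : ℕ) (U : Cl p q) : ℝ :=
  -((repMatrix β U).charpoly.coeff (repDim p q - k)).re

/-- `Det(U)` and the `C_{(k)}` are real: nothing is lost by taking real parts above. -/
def CharPolyIsReal {p q : ℕ} (β : Rep p q) (U : Cl p q) : Prop :=
  (repMatrix β U).det = (Det β U : ℂ) ∧
  (repMatrix β U).charpoly = Polynomial.X ^ repDim p q -
    ∑ k ∈ Finset.Icc 1 (repDim p q),
      Polynomial.C (charCoeff β k U : ℂ) * Polynomial.X ^ (repDim p q - k)

/-- `V` is the adjugate of `U`. -/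
def IsAdj {p q : ℕ} (β : Rep p q) (U V : Cl p q) : Prop :=
  V * U = algebraMap ℝ (Cl p q) (Det β U) ∧
  U * V = algebraMap ℝ (Cl p q) (Det β U) ∧
  repMatrix β V = (repMatrix β U).adjugate

/-- `Adj(U)` exists, is unique and equals `F`; `U` is invertible exactly when `Det(U) ≠ 0`, and
then `U⁻¹ = F / Det(U)`. -/
def AdjAndInverse {p q : ℕ} (β : Rep p q) (U F : Cl p q) : Prop :=
  (∀ V : Cl p q, IsAdj β U V ↔ V = F) ∧
  (IsUnit U ↔ Det β U ≠ 0) ∧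
  (Det β U ≠ 0 → Ring.inverse U = (Det β U)⁻¹ • F)

end

end GeomAlg

open GeomAlg

/-! Let `W` be the Clifford conjugate of `U`. Conjugation is an anti-involution, so `X = U + W` and
`Y = U * W` are fixed by it, and fixed elements have no part of grade 1 or 2. For `n ≤ 2` they are
scalars, and `(s - U)(s - W)` is already a scalar polynomial. For `n = 3, 4` the nonscalar part of a
fixed `x` lives in grades 3 and 4, where distinct basis products anticommute and each squares to a
scalar. Hence `x (2⟨x⟩₀ - x)` is a scalar (`exists_sq_eq_of_cliffordConj_eq`), and the conjugate
`2⟨x⟩₀ - x` is `hat x` or `tri (hat x)`. With `T`, `H` the conjugates of `X`, `Y`, the product `(s -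
U)(s - W)(s² - s T + H)` is a scalar polynomial `g(s)` with real coefficients.

That `g` annihilates `β(U)` does not make it the characteristic polynomial. The missing information
is a trace: the cofactor `F(s)` of `s - U` has trace `g'(s)`, so `g'/g` is the trace of the
resolvent, which is also the logarithmic derivative of the characteristic polynomial; both are monic
of degree `N`, hence equal (`Matrix.charpoly_eq_of_resolvent`, `exists_charpoly_and_adjugate`). The
adjugate comes from `F` at `s = 0`.

The trace condition is verified inside the algebra because the trace of `β(x)` is `N⟨x⟩₀` for every
`β` (`trace_repHom`). Every nonscalar basis product anticommutes with some generator, except the top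
one for odd `n`, which `trace_repHom_genProd_univ` treats. The same trace form gives the injectivity
needed for the existence of `β` (`nonempty_rep`). -/

/-! ### Characteristic polynomial and adjugate from a multiple of the resolvent. -/

/-- Two monic polynomials of the same degree with equal logarithmic derivatives agree. -/
theorem Polynomial.eq_of_derivative_mul_eq {K : Type*} [Field K] [CharZero K] {f g : K[X]}
    (hf : f.Monic) (hg : g.Monic) (hd : f.natDegree = g.natDegree)
    (h : f.derivative * g = f * g.derivative) : f = g := by
  by_contra hne
  set D := f - g with hD
  have hD0 : D ≠ 0 := sub_ne_zero.2 hne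
  have hdeg : D.degree < f.degree :=
    Polynomial.degree_sub_lt_left (by rw [Polynomial.degree_eq_natDegree hf.ne_zero,
      Polynomial.degree_eq_natDegree hg.ne_zero, hd]) hf.ne_zero (by rw [hf, hg])
  have hlt : D.natDegree < f.natDegree := Polynomial.natDegree_lt_natDegree hD0 hdeg
  have h' : f * D.derivative = f.derivative * D := by
    rw [hD, Polynomial.derivative_sub, mul_sub, mul_sub, ← h]; ring
  obtain ⟨N, hN⟩ : ∃ N, f.natDegree = N + 1 := ⟨f.natDegree - 1, by omega⟩
  -- In `f * D' = f' * D` the coefficients at this degree are `deg D` and `deg f` times the leading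
  -- coefficient of `D`, forcing `deg D = deg f`, against `hlt`.
  have hc : (f.derivative * D).coeff (N + D.natDegree) = (N + 1 : K) * D.leadingCoeff := by
    rw [Polynomial.coeff_mul_add_eq_of_natDegree_le _ le_rfl, Polynomial.coeff_derivative, ← hN,
      hf.coeff_natDegree, one_mul, Polynomial.leadingCoeff]
    exact (Polynomial.natDegree_derivative_le f).trans (by omega)
  have hl : D.leadingCoeff ≠ 0 := Polynomial.leadingCoeff_ne_zero.2 hD0
  rcases hd0 : D.natDegree with _ | d
  · rw [← h', Polynomial.eq_C_of_natDegree_eq_zero hd0] at hc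
    simp only [Polynomial.derivative_C, mul_zero, Polynomial.coeff_zero] at hc
    rw [← Polynomial.eq_C_of_natDegree_eq_zero hd0] at hc
    exact mul_ne_zero (Nat.cast_add_one_ne_zero N) hl hc.symm
  · have e : N + (d + 1) = (N + 1) + d := by omega
    rw [← h', hd0, e, Polynomial.coeff_mul_add_eq_of_natDegree_le hN.le, ← hN,
      hf.coeff_natDegree, one_mul, Polynomial.coeff_derivative, ← hd0,
      ← Polynomial.leadingCoeff, mul_comm] at hc
    · have := mul_right_cancel₀ hl hc
      have : d = N := by exact_mod_cast add_right_cancel this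
      omega
    · exact (Polynomial.natDegree_derivative_le D).trans (by omega)

namespace Matrix

variable {ι : Type*} [Fintype ι] [DecidableEq ι]

/-- Jacobi's formula for the characteristic polynomial, away from the eigenvalues. -/
theorem eval_derivative_charpoly {K : Type*} [Field K] [Infinite K] (B : Matrix ι ι K) (z : K)
    (hz : (scalar ι z - B).det ≠ 0) :
    B.charpoly.derivative.eval z = (scalar ι z - B).adjugate.trace := by
  set A := scalar ι z - B with hA
  have hu : IsUnit A.det := isUnit_iff_ne_zero.2 hz
  -- Translating by `z` gives `det A * det (1 + X A⁻¹)`, whose derivative at `0` is `det A * tr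
  -- A⁻¹`, the trace of the adjugate of `A`.
  have key : B.charpoly.comp (Polynomial.X + Polynomial.C z) =
      Polynomial.C A.det * (1 + (Polynomial.X : K[X]) • A⁻¹.map Polynomial.C).det := by
    refine Polynomial.funext fun r => ?_
    rw [Polynomial.eval_comp, eval_charpoly, Polynomial.eval_mul, Polynomial.eval_C,
      ← Polynomial.coe_evalRingHom, RingHom.map_det, ← det_mul]
    congr 1
    have : (Polynomial.evalRingHom r).mapMatrix
        (1 + (Polynomial.X : K[X]) • A⁻¹.map Polynomial.C) = 1 + r • A⁻¹ := by
      ext i j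
      by_cases h : i = j <;> simp [h] <;> ring
    rw [this, mul_add, mul_one, mul_smul_comm, mul_nonsing_inv _ hu, hA]
    simp only [Polynomial.coe_evalRingHom, Polynomial.eval_X, Polynomial.eval_C, map_add]
    rw [show scalar ι r = r • (1 : Matrix ι ι K) by ext i j; by_cases h : i = j <;> simp [h]]
    abel
  have := congrArg (fun P => (Polynomial.derivative P).eval 0) key
  simp only [Polynomial.derivative_comp, Polynomial.derivative_C_mul, Polynomial.eval_mul,
    Polynomial.eval_C, derivative_det_one_add_X_smul] at this
  simp only [Polynomial.derivative_add, Polynomial.derivative_X, Polynomial.derivative_C,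
    Polynomial.eval_comp, Polynomial.eval_add, Polynomial.eval_X, Polynomial.eval_C, add_zero,
    zero_add, Polynomial.eval_one, one_mul] at this
  rw [this, ← smul_eq_mul, ← trace_smul, inv_def, smul_smul,
    Ring.mul_inverse_cancel _ hu, one_smul]

/-- Identities in a real parameter `s` may be checked off the eigenvalues: the complement is
infinite, which suffices for polynomials, and dense, which suffices for continuous functions. -/
theorem finite_setOf_det_scalar_sub_eq_zero (B : Matrix ι ι ℂ) :
    {s : ℝ | (scalar ι (s : ℂ) - B).det = 0}.Finite := by
  refine ((B.charpoly.roots.toFinset.finite_toSet).preimage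
    Complex.ofReal_injective.injOn).subset fun s hs => ?_
  simpa [B.charpoly_monic.ne_zero, Polynomial.IsRoot, eval_charpoly] using hs

/-- A monic polynomial `g` and a multiple `F` of the resolvent of `B` with trace `g'` determine
the characteristic polynomial. -/
theorem charpoly_eq_of_resolvent {B : Matrix ι ι ℂ} {F : ℝ → Matrix ι ι ℂ} {g : ℂ[X]}
    (hg : g.Monic) (hd : g.natDegree = Fintype.card ι)
    (hF : ∀ s : ℝ, (scalar ι (s : ℂ) - B) * F s = g.eval (s : ℂ) • 1)
    (htr : ∀ s : ℝ, (F s).trace = g.derivative.eval (s : ℂ)) : B.charpoly = g := by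
  refine Polynomial.eq_of_derivative_mul_eq B.charpoly_monic hg
    (by rw [hd, charpoly_natDegree_eq_dim]) ?_
  refine Polynomial.eq_of_infinite_eval_eq _ _
    (((finite_setOf_det_scalar_sub_eq_zero B).infinite_compl.image
      Complex.ofReal_injective.injOn).mono ?_)
  rintro _ ⟨s, hs, rfl⟩
  have h1 := congrArg (fun M => ((scalar ι (s : ℂ) - B).adjugate * M).trace) (hF s)
  simp only [← mul_assoc, adjugate_mul, smul_mul_assoc, one_mul, trace_smul, mul_smul_comm,
    mul_one, htr s, smul_eq_mul] at h1
  rw [Set.mem_ofPred_eq, Polynomial.eval_mul, Polynomial.eval_mul, eval_derivative_charpoly B _ hs,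
    eval_charpoly, h1, mul_comm]

/-- Off the eigenvalues both sides are the determinant times the inverse. Continuity carries the
equality to every `s`, in particular to `s = 0` when `B` is singular. -/
theorem adjugate_eq_of_resolvent {B : Matrix ι ι ℂ} {F : ℝ → Matrix ι ι ℂ} {g : ℂ[X]}
    (hg : B.charpoly = g) (hc : Continuous F)
    (hF : ∀ s : ℝ, (scalar ι (s : ℂ) - B) * F s = g.eval (s : ℂ) • 1) (s : ℝ) :
    (scalar ι (s : ℂ) - B).adjugate = F s := by
  have hdense : Dense {s : ℝ | (scalar ι (s : ℂ) - B).det = 0}ᶜ :=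
    (finite_setOf_det_scalar_sub_eq_zero B).countable.dense_compl ℝ
  have hcont : Continuous fun s : ℝ => (scalar ι (s : ℂ) - B).adjugate := by
    refine Continuous.matrix_adjugate (Continuous.sub ?_ continuous_const)
    exact Continuous.matrix_diagonal (continuous_pi fun _ => Complex.continuous_ofReal)
  refine congrFun (hcont.ext_on hdense hc fun s hs => ?_) s
  have h1 := congrArg (fun M => (scalar ι (s : ℂ) - B).adjugate * M) (hF s)
  simp only [← mul_assoc, adjugate_mul, smul_mul_assoc, one_mul, mul_smul_comm, mul_one, ← hg,
    eval_charpoly] at h1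
  exact ((smul_right_injective _ hs) h1).symm

end Matrix

theorem Matrix.adjugate_neg_eq {ι R : Type*} [Fintype ι] [DecidableEq ι] [CommRing R]
    (M : Matrix ι ι R) : (-M).adjugate = (-1 : R) ^ (Fintype.card ι - 1) • M.adjugate := by
  rw [← neg_one_smul R M, Matrix.adjugate_smul]

/-! ### Algebras with a trace form and quadratic fixed points. -/

section TraceForm

variable {ι A : Type*} [Fintype ι] [DecidableEq ι] [Ring A] [Algebra ℝ A]

theorem AlgHom.map_smul_one_sub (ρ : A →ₐ[ℝ] Matrix ι ι ℂ) (s : ℝ) (U : A) :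
    ρ (s • 1 - U) = Matrix.scalar ι (s : ℂ) - ρ U := by
  rw [map_sub, map_smul, map_one]
  congr 1
  ext i j
  by_cases h : i = j <;> simp [h]

theorem AlgHom.map_smul_one_eq (ρ : A →ₐ[ℝ] Matrix ι ι ℂ) (s : ℝ) :
    ρ (s • 1) = (s : ℂ) • 1 := by
  rw [map_smul, map_one]
  ext i j
  by_cases h : i = j <;> simp [h]

theorem AlgHom.continuous_comp_polynomial (ρ : A →ₐ[ℝ] Matrix ι ι ℂ) (a b c d : A) :
    Continuous fun s : ℝ => ρ (s ^ 3 • a + s ^ 2 • b + s • c + d) := by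
  simp only [map_add, map_smul]
  fun_prop

/-- If `(s - U)(s - W)` has central values for all `s`, it gives the characteristic polynomial and
the adjugate of the matrix of `U`. -/
theorem charpoly_and_adjugate_of_quadratic (ρ : A →ₐ[ℝ] Matrix ι ι ℂ) (τ : A →ₗ[ℝ] ℝ)
    (hτ : τ 1 = 1) (htr : ∀ x, (ρ x).trace = Fintype.card ι * (τ x : ℂ))
    (hι : Fintype.card ι = 2) {U W : A} {c₁ c₂ : ℝ} (h₁ : U + W = c₁ • 1) (h₂ : U * W = c₂ • 1)
    (t₁ : 2 * τ W = c₁) :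
    (ρ U).charpoly = .X ^ 2 - .C (c₁ : ℂ) * .X + .C (c₂ : ℂ) ∧ (ρ U).adjugate = ρ W := by
  set g : ℂ[X] := .X ^ 2 - .C (c₁ : ℂ) * .X + .C (c₂ : ℂ) with hg
  have hd : g.natDegree = 2 := by rw [hg]; compute_degree!
  have hm : g.Monic := by rw [hg]; monicity!
  have hF (s : ℝ) : (Matrix.scalar ι (s : ℂ) - ρ U) * ρ (s • 1 - W) = g.eval (s : ℂ) • 1 := by
    have : (s • 1 - U) * (s • 1 - W) = (s ^ 2 - c₁ * s + c₂) • 1 := by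
      calc (s • 1 - U) * (s • 1 - W) = s ^ 2 • 1 - s • (U + W) + U * W := by
            simp only [mul_sub, sub_mul, mul_one, one_mul, smul_mul_assoc, mul_smul_comm]
            module
        _ = _ := by rw [h₁, h₂]; module
    rw [← ρ.map_smul_one_sub, ← map_mul, this, ρ.map_smul_one_eq]
    simp [hg]
  have hch : (ρ U).charpoly = g := by
    refine Matrix.charpoly_eq_of_resolvent hm (hd.trans hι.symm) hF fun s => ?_
    rw [htr, map_sub, map_smul, hτ, hι]
    simp only [hg, Polynomial.derivative_add, Polynomial.derivative_sub, Polynomial.derivative_C,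
      Polynomial.derivative_X_pow, Polynomial.derivative_C_mul, Polynomial.derivative_X]
    simp [← t₁]
    ring
  refine ⟨hch, ?_⟩
  -- At `s = 0` this is the adjugate of `-ρ U` against `-ρ W`; the signs cancel since the size is
  -- even.
  have := Matrix.adjugate_eq_of_resolvent hch
    ((ρ.continuous_comp_polynomial 0 0 1 (-W)).congr fun s => by simp [sub_eq_add_neg]) hF 0
  simpa [Matrix.adjugate_neg_eq, hι] using this

/-- If `(s - U)(s - W)(s² - s T + H)` has central values for all `s`, it gives the characteristic
polynomial and the adjugate of the matrix of `U`. -/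
theorem charpoly_and_adjugate_of_quartic (ρ : A →ₐ[ℝ] Matrix ι ι ℂ) (τ : A →ₗ[ℝ] ℝ)
    (hτ : τ 1 = 1) (htr : ∀ x, (ρ x).trace = Fintype.card ι * (τ x : ℂ))
    (hι : Fintype.card ι = 4) {U W T H : A} {c₁ c₂ c₃ c₄ : ℝ}
    (h₁ : U + W + T = c₁ • 1) (h₂ : (U + W) * T + U * W + H = c₂ • 1)
    (h₃ : (U + W) * H + U * W * T = c₃ • 1) (h₄ : U * W * H = c₄ • 1)
    (t₁ : 4 * τ (W + T) = 3 * c₁) (t₂ : 4 * τ (H + W * T) = 2 * c₂) (t₃ : 4 * τ (W * H) = c₃) :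
    (ρ U).charpoly = .X ^ 4 - .C (c₁ : ℂ) * .X ^ 3 + .C (c₂ : ℂ) * .X ^ 2 - .C (c₃ : ℂ) * .X
        + .C (c₄ : ℂ) ∧
      (ρ U).adjugate = ρ (W * H) := by
  set g : ℂ[X] := .X ^ 4 - .C (c₁ : ℂ) * .X ^ 3 + .C (c₂ : ℂ) * .X ^ 2 - .C (c₃ : ℂ) * .X
        + .C (c₄ : ℂ) with hg
  have hd : g.natDegree = 4 := by rw [hg]; compute_degree!
  have hm : g.Monic := by rw [hg]; monicity!
  have expand (s : ℝ) : (s • 1 - W) * (s ^ 2 • 1 - s • T + H) =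
      s ^ 3 • 1 + s ^ 2 • (-(W + T)) + s • (H + W * T) + (-(W * H)) := by
    simp only [mul_sub, sub_mul, mul_one, one_mul, smul_mul_assoc, mul_smul_comm, mul_add]
    module
  have hF (s : ℝ) : (Matrix.scalar ι (s : ℂ) - ρ U) *
      ρ (s ^ 3 • 1 + s ^ 2 • (-(W + T)) + s • (H + W * T) + (-(W * H)))
        = g.eval (s : ℂ) • 1 := by
    have : (s • 1 - U) * ((s • 1 - W) * (s ^ 2 • 1 - s • T + H)) =
        (s ^ 4 - c₁ * s ^ 3 + c₂ * s ^ 2 - c₃ * s + c₄) • 1 := by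
      calc (s • 1 - U) * ((s • 1 - W) * (s ^ 2 • 1 - s • T + H))
          = s ^ 4 • 1 - s ^ 3 • (U + W + T) + s ^ 2 • ((U + W) * T + U * W + H)
            - s • ((U + W) * H + U * W * T) + U * W * H := by
            simp only [mul_sub, sub_mul, mul_one, one_mul, smul_mul_assoc, mul_smul_comm, mul_add,
              add_mul, mul_assoc]
            module
        _ = _ := by rw [h₁, h₂, h₃, h₄]; module
    rw [← expand, ← ρ.map_smul_one_sub, ← map_mul, this, ρ.map_smul_one_eq]
    simp [hg]
  have hch : (ρ U).charpoly = g := by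
    refine Matrix.charpoly_eq_of_resolvent hm (hd.trans hι.symm) hF fun s => ?_
    -- The hypotheses `t₁`, `t₂`, `t₃` are the coefficients of the trace condition: the right side
    -- is the derivative of `g`.
    have e : 4 * τ (s ^ 3 • 1 + s ^ 2 • (-(W + T)) + s • (H + W * T) + (-(W * H))) =
        4 * s ^ 3 - 3 * c₁ * s ^ 2 + 2 * c₂ * s - c₃ := by
      rw [map_add, map_add, map_add, map_smul, map_smul, map_smul, hτ, map_neg, map_neg]
      simp only [smul_eq_mul]
      linear_combination (-s ^ 2) * t₁ + s * t₂ - t₃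
    rw [htr, hι]
    have := congrArg (fun r : ℝ => (r : ℂ)) e
    push_cast at this ⊢
    rw [this]
    simp only [hg, Polynomial.derivative_add, Polynomial.derivative_sub, Polynomial.derivative_C,
      Polynomial.derivative_X_pow, Polynomial.derivative_C_mul, Polynomial.derivative_X]
    simp
    ring
  refine ⟨hch, ?_⟩
  have := Matrix.adjugate_eq_of_resolvent hch (ρ.continuous_comp_polynomial _ _ _ _) hF 0
  simpa [Matrix.adjugate_neg_eq, hι, pow_succ] using this

/-- The characteristic polynomial and adjugate in an algebra with an anti-involution `σ`, preserving
a trace form, whose fixed points generate quadratic algebras over the scalars. -/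
theorem exists_charpoly_and_adjugate (ρ : A →ₐ[ℝ] Matrix ι ι ℂ) (τ : A →ₗ[ℝ] ℝ)
    (hτ : τ 1 = 1) (htr : ∀ x, (ρ x).trace = Fintype.card ι * (τ x : ℂ))
    (hι : Fintype.card ι = 4) (σ : A →ₗ[ℝ] A) (hmul : ∀ x y, σ (x * y) = σ y * σ x)
    (hσ : ∀ x, σ (σ x) = x) (hτσ : ∀ x, τ (σ x) = τ x)
    (hfix : ∀ x, σ x = x → ∃ r : ℝ, (x - τ x • 1) * (x - τ x • 1) = r • 1)
    {U T H : A} (hT : T = (2 * τ (U + σ U)) • 1 - (U + σ U))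
    (hH : H = (2 * τ (U * σ U)) • 1 - U * σ U) :
    ∃ c₁ c₂ c₃ c₄ : ℝ, U + σ U + T = c₁ • 1 ∧ (U + σ U) * T + U * σ U + H = c₂ • 1 ∧
      (U + σ U) * H + U * σ U * T = c₃ • 1 ∧ U * σ U * H = c₄ • 1 ∧
      (ρ U).charpoly = .X ^ 4 - .C (c₁ : ℂ) * .X ^ 3 + .C (c₂ : ℂ) * .X ^ 2 - .C (c₃ : ℂ) * .X
        + .C (c₄ : ℂ) ∧
      (ρ U).adjugate = ρ (σ U * H) := by
  have hcomm (x y : A) : τ (x * y) = τ (y * x) := by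
    have h : (ρ (x * y)).trace = (ρ (y * x)).trace := by
      rw [map_mul, map_mul, Matrix.trace_mul_comm]
    rw [htr, htr, hι] at h
    exact_mod_cast mul_left_cancel₀ (by norm_num) h
  have hq (x : A) (hx : σ x = x) : ∃ r : ℝ, x * ((2 * τ x) • 1 - x) = r • 1 := by
    obtain ⟨r, hr⟩ := hfix x hx
    -- With `v = x - τ x` this is `(τ x + v)(τ x - v) = τ x ^ 2 - v ^ 2`.
    refine ⟨τ x ^ 2 - r, ?_⟩
    rw [sub_smul, ← hr]
    simp only [mul_sub, sub_mul, mul_one, one_mul, smul_mul_assoc, mul_smul_comm]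
    module
  have hfT : σ (U + σ U) = U + σ U := by rw [map_add, hσ, add_comm]
  have hfH : σ (U * σ U) = U * σ U := by rw [hmul, hσ]
  obtain ⟨q₁, hq₁⟩ := hq _ hfT
  obtain ⟨q₂, hq₂⟩ := hq _ hfH
  -- Polarization: the quadratic relation for the sum makes the mixed terms in `e₃` scalar.
  obtain ⟨q₃, hq₃⟩ := hq (U + σ U + U * σ U) (by rw [map_add, hfT, hfH])
  have e₁ : U + σ U + T = (4 * τ U) • 1 := by
    rw [hT, map_add, hτσ]; module
  have e₂ : (U + σ U) * T + U * σ U + H = (q₁ + 2 * τ (U * σ U)) • 1 := by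
    rw [hT, hH, hq₁]; module
  have e₃ : (U + σ U) * H + U * σ U * T = (q₃ - q₁ - q₂) • 1 := by
    rw [sub_smul, sub_smul, ← hq₃, ← hq₂, ← hq₁, hT, hH, map_add τ (U + σ U)]
    simp only [mul_sub, mul_one, mul_smul_comm, mul_add, add_mul]
    module
  have hσ1 : σ 1 = 1 := by
    have := hmul (σ 1) 1
    rw [mul_one, hσ, mul_one] at this
    exact this.symm
  have hσT : σ T = T := by rw [hT, map_sub, map_smul, hfT, hσ1]
  have hσH : σ H = H := by rw [hH, map_sub, map_smul, hfH, hσ1]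
  -- Against fixed elements `U` and `σ U` have the same trace, so the trace of `(U + σ U) * X` is
  -- twice that of `σ U * X`. This turns `e₂` and `e₃` into the trace conditions.
  have hW (X : A) (hX : σ X = X) : τ (σ U * X) = τ (U * X) := by
    rw [← hτσ, hmul, hσ, hX, hcomm]
  have e₄ : U * σ U * H = q₂ • 1 := by rw [hH, hq₂]
  refine ⟨_, _, _, _, e₁, e₂, e₃, e₄,
    charpoly_and_adjugate_of_quartic ρ τ hτ htr hι e₁ e₂ e₃ e₄ ?_ ?_ ?_⟩
  · rw [hT, map_add, map_sub, map_smul, map_add, hτ, hτσ, smul_eq_mul]; ring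
  · have h := congrArg τ e₂
    have hτH : τ H = τ (U * σ U) := by rw [hH, map_sub, map_smul, hτ, smul_eq_mul]; ring
    rw [map_add, map_add, map_smul, hτ, add_mul, map_add, ← hW T hσT, smul_eq_mul] at h
    rw [map_add]
    linarith
  · have h := congrArg τ e₃
    have h' : τ (U * σ U * T) = τ ((U + σ U) * H) := by
      rw [hT, hH, mul_sub, mul_sub, map_sub, map_sub, hcomm (U * σ U) (U + σ U)]
      simp only [mul_smul_comm, mul_one, map_smul, smul_eq_mul]
      ring
    rw [map_add, h', map_smul, hτ, add_mul, map_add, ← hW H hσH, smul_eq_mul] at h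
    linarith

end TraceForm

/-! ### Commutation and squares of products of generators. -/

namespace GeomAlg

variable {p q : ℕ}

/-- Lists of distinct indices allow induction on the number of factors. -/
theorem exists_list_genProd (A : Finset (Fin (p + q))) :
    ∃ l : List (Fin (p + q)), l.Nodup ∧ l.toFinset = A ∧ (genProd A : Cl p q) = (l.map gen).prod := by
  refine ⟨List.ofFn fun i => A.orderEmbOfFin rfl i,
    List.nodup_ofFn.2 (A.orderEmbOfFin rfl).injective, ?_, ?_⟩
  · ext a
    rw [List.mem_toFinset, List.mem_ofFn', A.range_orderEmbOfFin rfl, Finset.mem_coe]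
  · rw [List.map_ofFn]; rfl

/-- Each letter different from `a` contributes a sign. Adding the count instead of subtracting it
gives the same parity. -/
theorem prod_map_gen_mul_gen (l : List (Fin (p + q))) (a : Fin (p + q)) :
    (l.map gen).prod * gen a =
      (-1 : ℝ) ^ (l.length + l.count a) • (gen a * (l.map gen).prod : Cl p q) := by
  induction l with
  | nil => simp
  | cons b l ih =>
    rw [List.map_cons, List.prod_cons, mul_assoc, ih, mul_smul_comm, ← mul_assoc, ← mul_assoc]
    by_cases h : b = a
    · subst h
      rw [List.length_cons, List.count_cons_self]
      congr 1
      ring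
    · rw [gen_mul_gen_of_ne h, List.length_cons, List.count_cons_of_ne h]
      simp only [pow_add, pow_one, neg_mul, mul_neg, mul_one, smul_neg, neg_smul]

theorem genProd_mul_gen (A : Finset (Fin (p + q))) (a : Fin (p + q)) :
    genProd A * gen a =
      (-1 : ℝ) ^ (A.card + if a ∈ A then 1 else 0) • (gen a * genProd A : Cl p q) := by
  obtain ⟨l, hl, rfl, h⟩ := exists_list_genProd A
  rw [h, prod_map_gen_mul_gen, List.toFinset_card_of_nodup hl, hl.count]
  simp only [List.mem_toFinset]

theorem genProd_mul_prod_map_gen (A : Finset (Fin (p + q))) (l : List (Fin (p + q))) :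
    genProd A * (l.map gen).prod =
      (-1 : ℝ) ^ (l.map fun a => A.card + if a ∈ A then 1 else 0).sum •
        ((l.map gen).prod * genProd A : Cl p q) := by
  induction l with
  | nil => simp
  | cons b l ih =>
    rw [List.map_cons, List.prod_cons, ← mul_assoc, genProd_mul_gen, smul_mul_assoc, mul_assoc, ih,
      mul_smul_comm, smul_smul, ← pow_add, List.map_cons, List.sum_cons, mul_assoc]

theorem genProd_mul_genProd (A B : Finset (Fin (p + q))) :
    genProd A * genProd B =
      (-1 : ℝ) ^ (A.card * B.card + (A ∩ B).card) • (genProd B * genProd A : Cl p q) := by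
  obtain ⟨l, hl, rfl, h⟩ := exists_list_genProd B
  rw [h, genProd_mul_prod_map_gen, ← List.sum_toFinset _ hl, Finset.sum_add_distrib,
    Finset.sum_const, Finset.sum_boole, Finset.filter_mem_eq_inter, Finset.inter_comm, smul_eq_mul,
    mul_comm A.card]
  simp

theorem signature_ne_zero (a : Fin (p + q)) : (if (a : ℕ) < p then (1 : ℝ) else -1) ≠ 0 := by
  split_ifs <;> norm_num

/-- The product collapses from the middle outwards, each pair of equal generators contributing its
signature. -/
theorem exists_prod_mul_reverse (l : List (Fin (p + q))) :
    ∃ c : ℝ, c ≠ 0 ∧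
      (l.map gen).prod * CliffordAlgebra.reverse (l.map gen).prod = algebraMap ℝ (Cl p q) c := by
  induction l with
  | nil => exact ⟨1, one_ne_zero, by simp⟩
  | cons b l ih =>
    obtain ⟨c, hc, h⟩ := ih
    refine ⟨_, mul_ne_zero hc (signature_ne_zero b), ?_⟩
    rw [List.map_cons, List.prod_cons, CliffordAlgebra.reverse.map_mul,
      show CliffordAlgebra.reverse (gen b : Cl p q) = gen b from CliffordAlgebra.reverse_ι _,
      mul_assoc, ← mul_assoc (List.prod _), h, ← mul_assoc, ← Algebra.commutes, mul_assoc,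
      gen_mul_self, map_mul]

theorem exists_genProd_mul_self (A : Finset (Fin (p + q))) :
    ∃ c : ℝ, c ≠ 0 ∧ genProd A * genProd A = c • (1 : Cl p q) := by
  obtain ⟨l, hl, rfl, h⟩ := exists_list_genProd A
  obtain ⟨c, hc, hc'⟩ := exists_prod_mul_reverse l
  rw [reverse_prod_gen l hl, mul_smul_comm, Algebra.algebraMap_eq_smul_one] at hc'
  refine ⟨(-1) ^ l.length.choose 2 * c, mul_ne_zero (pow_ne_zero _ (by norm_num)) hc, ?_⟩
  rw [h, mul_smul, ← hc', smul_smul, ← pow_add, Even.neg_one_pow ⟨_, rfl⟩, one_smul]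

theorem genProd_empty : (genProd ∅ : Cl p q) = 1 := by
  obtain ⟨l, hl, hA, h⟩ := exists_list_genProd (p := p) (q := q) ∅
  rw [h, (List.toFinset_eq_empty_iff l).1 hA]
  simp

/-- The scalar part `⟨U⟩₀` as a real number. -/
noncomputable def scalarPart (p q : ℕ) : Cl p q →ₗ[ℝ] ℝ := (bladeBasis p q).coord ∅

theorem scalarPart_genProd (A : Finset (Fin (p + q))) :
    scalarPart p q (genProd A) = if A = ∅ then 1 else 0 := by
  rw [scalarPart, ← bladeBasis_apply, Module.Basis.coord_apply, Module.Basis.repr_self,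
    Finsupp.single_apply]

theorem scalarPart_one : scalarPart p q 1 = 1 := by
  rw [← genProd_empty, scalarPart_genProd, if_pos rfl]

theorem repr_specialConj (j : ℕ) (U : Cl p q) (A : Finset (Fin (p + q))) :
    (bladeBasis p q).repr (specialConj j U) A =
      (-1) ^ A.card.choose (2 ^ (j - 1)) * (bladeBasis p q).repr U A := by
  rw [specialConj_eq, map_sum, Finsupp.finsetSum_apply, Finset.sum_eq_single A]
  · simp [mul_comm]
  · intro B _ hB
    simp [hB]
  · simp

theorem repr_hat (U : Cl p q) (A : Finset (Fin (p + q))) :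
    (bladeBasis p q).repr (hat U) A = (-1) ^ A.card * (bladeBasis p q).repr U A := by
  rw [hat_eq, repr_specialConj]; simp

theorem repr_tilde (U : Cl p q) (A : Finset (Fin (p + q))) :
    (bladeBasis p q).repr (tilde U) A = (-1) ^ A.card.choose 2 * (bladeBasis p q).repr U A := by
  rw [tilde_eq, repr_specialConj]; rfl

theorem repr_tri (U : Cl p q) (A : Finset (Fin (p + q))) :
    (bladeBasis p q).repr (tri U) A = (-1) ^ A.card.choose 4 * (bladeBasis p q).repr U A := by
  rw [tri, repr_specialConj]; rfl

/-! ### Clifford conjugation and its fixed points. -/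

/-- Clifford conjugation. -/
noncomputable def cliffordConj (p q : ℕ) : Cl p q →ₗ[ℝ] Cl p q :=
  CliffordAlgebra.involute.toLinearMap ∘ₗ CliffordAlgebra.reverse

theorem cliffordConj_apply (U : Cl p q) : cliffordConj p q U = hat (tilde U) := rfl

theorem hat_mul (U V : Cl p q) : hat (U * V) = hat U * hat V := map_mul _ _ _

theorem hat_hat (U : Cl p q) : hat (hat U) = U := CliffordAlgebra.involute_involute U

theorem hat_add (U V : Cl p q) : hat (U + V) = hat U + hat V := map_add _ _ _

theorem tri_add (U V : Cl p q) : tri (U + V) = tri U + tri V := by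
  refine (bladeBasis p q).ext_elem fun A => ?_
  simp only [map_add, Finsupp.add_apply, repr_tri, mul_add]

theorem cliffordConj_mul (U V : Cl p q) :
    cliffordConj p q (U * V) = cliffordConj p q V * cliffordConj p q U := by
  rw [cliffordConj_apply, tilde, CliffordAlgebra.reverse.map_mul, hat_mul]; rfl

theorem cliffordConj_cliffordConj (U : Cl p q) : cliffordConj p q (cliffordConj p q U) = U := by
  simp only [cliffordConj_apply, hat, tilde, CliffordAlgebra.reverse_involute,
    CliffordAlgebra.reverse_reverse, CliffordAlgebra.involute_involute]

theorem repr_cliffordConj (U : Cl p q) (A : Finset (Fin (p + q))) :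
    (bladeBasis p q).repr (cliffordConj p q U) A =
      (-1) ^ (A.card + A.card.choose 2) * (bladeBasis p q).repr U A := by
  rw [cliffordConj_apply, repr_hat, repr_tilde, pow_add, mul_assoc]

theorem scalarPart_cliffordConj (U : Cl p q) :
    scalarPart p q (cliffordConj p q U) = scalarPart p q U := by
  rw [scalarPart, Module.Basis.coord_apply, repr_cliffordConj]; simp

theorem card_le_sum (A : Finset (Fin (p + q))) : A.card ≤ p + q := by
  simpa using A.card_le_univ

/-- The fixed points of Clifford conjugation have no part of grade `1` or `2`. -/
theorem repr_eq_zero_of_cliffordConj_eq {x : Cl p q} (hx : cliffordConj p q x = x)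
    {A : Finset (Fin (p + q))} (hA : A.card = 1 ∨ A.card = 2) : (bladeBasis p q).repr x A = 0 := by
  have h := repr_cliffordConj x A
  rw [hx] at h
  rcases hA with hA | hA <;> rw [hA] at h <;> norm_num [Nat.choose] at h <;> linarith

theorem repr_smul_one (c : ℝ) (A : Finset (Fin (p + q))) :
    (bladeBasis p q).repr (c • (1 : Cl p q)) A = if A = ∅ then c else 0 := by
  rw [← genProd_empty, ← bladeBasis_apply, map_smul, Module.Basis.repr_self, Finsupp.smul_apply,
    Finsupp.single_apply, smul_eq_mul]
  simp only [eq_comm (a := A), mul_ite, mul_one, mul_zero]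

theorem eq_smul_one_of_cliffordConj_eq (h2 : p + q ≤ 2) {x : Cl p q}
    (hx : cliffordConj p q x = x) : x = scalarPart p q x • 1 := by
  refine (bladeBasis p q).ext_elem fun A => ?_
  rw [repr_smul_one]
  split_ifs with hA
  · subst hA; rfl
  · have := card_le_sum A
    have := Finset.card_pos.2 (Finset.nonempty_iff_ne_empty.2 hA)
    exact repr_eq_zero_of_cliffordConj_eq hx (by omega)

/-- Fixed elements live in grades 0 and 3, and the grade involution negates grade 3. So here it
realizes the quadratic conjugate. -/
theorem hat_eq_of_cliffordConj_eq (h3 : p + q ≤ 3) {x : Cl p q} (hx : cliffordConj p q x = x) :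
    hat x = (2 * scalarPart p q x) • 1 - x := by
  refine (bladeBasis p q).ext_elem fun A => ?_
  rw [repr_hat, map_sub, Finsupp.sub_apply, repr_smul_one]
  split_ifs with hA
  · subst hA
    simp only [Finset.card_empty, pow_zero, scalarPart, Module.Basis.coord_apply]
    ring
  · have := card_le_sum A
    have := Finset.card_pos.2 (Finset.nonempty_iff_ne_empty.2 hA)
    by_cases h : A.card = 1 ∨ A.card = 2
    · rw [repr_eq_zero_of_cliffordConj_eq hx h]; simp
    · rw [show A.card = 3 by omega]; ring

/-- The grade involution negates grade 3 but keeps grade 4; `tri` keeps grade 3 and negates grade 4.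
Both are needed to realize the quadratic conjugate. -/
theorem tri_hat_eq_of_cliffordConj_eq (h4 : p + q ≤ 4) {x : Cl p q}
    (hx : cliffordConj p q x = x) : tri (hat x) = (2 * scalarPart p q x) • 1 - x := by
  refine (bladeBasis p q).ext_elem fun A => ?_
  rw [repr_tri, repr_hat, map_sub, Finsupp.sub_apply, repr_smul_one]
  split_ifs with hA
  · subst hA
    simp only [Finset.card_empty, pow_zero, scalarPart, Module.Basis.coord_apply, Nat.choose]
    ring
  · have := card_le_sum A
    have := Finset.card_pos.2 (Finset.nonempty_iff_ne_empty.2 hA)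
    by_cases h : A.card = 1 ∨ A.card = 2
    · rw [repr_eq_zero_of_cliffordConj_eq hx h]; simp
    · obtain h | h : A.card = 3 ∨ A.card = 4 := by omega
      all_goals rw [h]; norm_num [Nat.choose]

/-- For `n ≤ 4` distinct basis elements of grades `3` and `4` anticommute. -/
theorem genProd_anticomm (h4 : p + q ≤ 4) {A B : Finset (Fin (p + q))} (hA : 3 ≤ A.card)
    (hB : 3 ≤ B.card) (hAB : A ≠ B) :
    (genProd A * genProd B + genProd B * genProd A : Cl p q) = 0 := by
  have h1 := card_le_sum (A ∪ B)
  have h2 := Finset.card_union_add_card_inter A B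
  have h3 := Finset.card_le_card (Finset.inter_subset_left (s₁ := A) (s₂ := B))
  have h3' := Finset.card_le_card (Finset.inter_subset_right (s₁ := A) (s₂ := B))
  have h5 : ¬ ((A ∩ B).card = A.card ∧ (A ∩ B).card = B.card) := fun ⟨ha, hb⟩ =>
    hAB ((Finset.eq_of_subset_of_card_le Finset.inter_subset_left ha.ge).symm.trans
      (Finset.eq_of_subset_of_card_le Finset.inter_subset_right hb.ge))
  have hodd : Odd (A.card * B.card + (A ∩ B).card) := by
    obtain ⟨a, ha⟩ : ∃ a, a = A.card := ⟨_, rfl⟩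
    obtain ⟨b, hb⟩ : ∃ b, b = B.card := ⟨_, rfl⟩
    have := card_le_sum A
    have := card_le_sum B
    -- With at most four indices, either two triples share two indices, or one set is a triple
    -- inside the quadruple. The exponents are `11` and `15`.
    have h6 : (A ∩ B).card = 2 ∧ a = 3 ∧ b = 3 ∨ (A ∩ B).card = 3 ∧ a = 3 ∧ b = 4 ∨
      (A ∩ B).card = 3 ∧ a = 4 ∧ b = 3 := by omega
    rw [← ha, ← hb]
    rcases h6 with ⟨h, rfl, rfl⟩ | ⟨h, rfl, rfl⟩ | ⟨h, rfl, rfl⟩ <;> rw [h] <;> decide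
  rw [genProd_mul_genProd A B, hodd.neg_one_pow, neg_one_smul, neg_add_cancel]

theorem exists_sq_eq_of_cliffordConj_eq (h4 : p + q ≤ 4) {x : Cl p q}
    (hx : cliffordConj p q x = x) :
    ∃ r : ℝ, (x - scalarPart p q x • 1) * (x - scalarPart p q x • 1) = r • 1 := by
  set v := x - scalarPart p q x • 1 with hv
  have hv0 (A : Finset (Fin (p + q))) (hA : A.card < 3) : (bladeBasis p q).repr v A = 0 := by
    rw [hv, map_sub, Finsupp.sub_apply, repr_smul_one]
    split_ifs with h
    · subst h; exact sub_self _
    · have := Finset.card_pos.2 (Finset.nonempty_iff_ne_empty.2 h)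
      rw [repr_eq_zero_of_cliffordConj_eq hx (by omega), sub_zero]
  -- Doubling symmetrizes the double sum into anticommutators, whose off-diagonal terms vanish.
  have hmem : v * v + v * v ∈ Submodule.span ℝ {(1 : Cl p q)} := by
    have e : v * v + v * v = ∑ A, ∑ B, ((bladeBasis p q).repr v A * (bladeBasis p q).repr v B) •
        (genProd A * genProd B + genProd B * genProd A) := by
      simp only [smul_add, Finset.sum_add_distrib]
      have e' : v * v = ∑ A, ∑ B, ((bladeBasis p q).repr v A * (bladeBasis p q).repr v B) •
          (genProd A * genProd B) := by
        conv_lhs => rw [← (bladeBasis p q).sum_repr v, Finset.sum_mul_sum]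
        simp only [smul_mul_smul_comm, bladeBasis_apply]
      rw [← e']
      congr 1
      rw [e', Finset.sum_comm]
      simp only [mul_comm]
    rw [e]
    refine Submodule.sum_mem _ fun A _ => Submodule.sum_mem _ fun B _ => ?_
    by_cases hA : A.card < 3
    · simp [hv0 A hA]
    by_cases hB : B.card < 3
    · simp [hv0 B hB]
    by_cases hAB : A = B
    · subst hAB
      obtain ⟨c, -, hc⟩ := exists_genProd_mul_self A
      rw [hc]
      have := Submodule.mem_span_singleton_self (R := ℝ) (1 : Cl p q)
      exact Submodule.smul_mem _ _ (add_mem (Submodule.smul_mem _ _ this)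
        (Submodule.smul_mem _ _ this))
    · rw [genProd_anticomm h4 (by omega) (by omega) hAB, smul_zero]
      exact zero_mem _
  obtain ⟨r, hr⟩ := Submodule.mem_span_singleton.1 hmem
  refine ⟨r / 2, ?_⟩
  rw [← two_smul ℝ] at hr
  rw [div_eq_inv_mul, mul_smul, hr, smul_smul]
  norm_num

/-- In odd dimension the product of all generators is central. -/
theorem genProd_univ_commute (hodd : Odd (p + q)) (y : Cl p q) :
    genProd Finset.univ * y = y * genProd Finset.univ := by
  rw [← (bladeBasis p q).sum_repr y, Finset.mul_sum, Finset.sum_mul]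
  refine Finset.sum_congr rfl fun A _ => ?_
  rw [mul_smul_comm, smul_mul_assoc, bladeBasis_apply, genProd_mul_genProd, Finset.univ_inter,
    Finset.card_univ, Fintype.card_fin]
  have : Even ((p + q) * A.card + A.card) := by
    rw [← Nat.succ_mul]; exact hodd.add_one.mul_right _
  rw [this.neg_one_pow, one_smul]

/-- For `n = 3` the surviving grades 0 and 3 are spanned by `1` and the central top product. -/
theorem commute_of_cliffordConj_eq (h3 : p + q = 3) {x : Cl p q} (hx : cliffordConj p q x = x)
    (y : Cl p q) : x * y = y * x := by
  rw [← (bladeBasis p q).sum_repr x, Finset.mul_sum, Finset.sum_mul]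
  refine Finset.sum_congr rfl fun A _ => ?_
  rw [mul_smul_comm, smul_mul_assoc]
  by_cases h : A.card = 1 ∨ A.card = 2
  · rw [repr_eq_zero_of_cliffordConj_eq hx h]; simp
  · have := card_le_sum A
    rw [bladeBasis_apply]
    obtain h | h : A.card = 0 ∨ A.card = p + q := by omega
    · rw [Finset.card_eq_zero.1 h, genProd_empty, one_mul, mul_one]
    · rw [Finset.card_eq_iff_eq_univ A |>.1 (by simpa using h),
        genProd_univ_commute (by rw [h3]; decide)]

/-! ### Traces of basis products. -/

/-- The sign is odd for `a ∈ A` when `A` has even size and for `a ∉ A` when it has odd size; such an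
`a` is missing only in the excluded cases. -/
theorem exists_gen_anticomm {A : Finset (Fin (p + q))} (hA : A ≠ ∅)
    (h : A = Finset.univ → Even (p + q)) :
    ∃ a : Fin (p + q), (gen a * genProd A : Cl p q) = -(genProd A * gen a) := by
  obtain ⟨a, ha⟩ : ∃ a, Odd (A.card + if a ∈ A then 1 else 0) := by
    rcases Nat.even_or_odd A.card with he | ho
    · obtain ⟨a, ha⟩ := Finset.nonempty_iff_ne_empty.2 hA
      exact ⟨a, by rw [if_pos ha]; exact he.add_one⟩
    · have : A ≠ Finset.univ := by
        rintro rfl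
        have := h rfl
        rw [Finset.card_univ, Fintype.card_fin] at ho
        exact Nat.not_even_iff_odd.2 ho this
      obtain ⟨a, ha⟩ : ∃ a, a ∉ A := by
        simpa [Finset.eq_univ_iff_forall] using this
      exact ⟨a, by rwa [if_neg ha]⟩
  exact ⟨a, by rw [genProd_mul_gen, ha.neg_one_pow, neg_one_smul, neg_neg]⟩

section Trace

variable {ι : Type*} [Fintype ι] [DecidableEq ι]

/-- Conjugating by `gen a` multiplies the trace by `c` by cyclicity, and by `-c` by anticommutation.
-/
theorem trace_eq_zero_of_anticomm (ρ : Cl p q →ₐ[ℝ] Matrix ι ι ℂ) (a : Fin (p + q)) {y : Cl p q}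
    (h : gen a * y = -(y * gen a)) : (ρ y).trace = 0 := by
  set c : ℝ := if (a : ℕ) < p then 1 else -1 with hc
  have hg : (gen a * gen a : Cl p q) = c • 1 := by
    rw [gen_mul_self, Algebra.algebraMap_eq_smul_one]
  have h1 : (ρ (gen a * y * gen a)).trace = (ρ (c • y)).trace := by
    rw [map_mul, Matrix.trace_mul_comm, ← map_mul, ← mul_assoc, hg, smul_mul_assoc, one_mul]
  rw [h, neg_mul, mul_assoc, hg, mul_smul_comm, mul_one, map_neg, Matrix.trace_neg, map_smul,
    Matrix.trace_smul, neg_eq_iff_add_eq_zero, ← two_smul ℝ, smul_smul] at h1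
  exact (smul_eq_zero.1 h1).resolve_left (mul_ne_zero two_ne_zero (signature_ne_zero a))

/-- The trace of a representation is a multiple of the scalar part. -/
theorem trace_eq_scalarPart (ρ : Cl p q →ₐ[ℝ] Matrix ι ι ℂ)
    (hω : Odd (p + q) → (ρ (genProd Finset.univ)).trace = 0) (x : Cl p q) :
    (ρ x).trace = Fintype.card ι * (scalarPart p q x : ℂ) := by
  conv_lhs => rw [← (bladeBasis p q).sum_repr x]
  rw [map_sum, Matrix.trace_sum, Finset.sum_eq_single ∅]
  · rw [bladeBasis_apply, genProd_empty, map_smul, map_one, Matrix.trace_smul, Matrix.trace_one,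
      Complex.real_smul, mul_comm]
    rfl
  · intro A _ hA
    rw [map_smul, Matrix.trace_smul, bladeBasis_apply]
    suffices (ρ (genProd A)).trace = 0 by rw [this, smul_zero]
    by_cases h : A = Finset.univ → Even (p + q)
    · obtain ⟨a, ha⟩ := exists_gen_anticomm hA h
      exact trace_eq_zero_of_anticomm ρ a ha
    · push Not at h
      rw [h.1]
      exact hω (by simpa using h.2)
  · simp

end Trace

/-! ### Construction of a representation. -/

theorem hat_genProd (A : Finset (Fin (p + q))) :
    hat (genProd A : Cl p q) = (-1 : ℝ) ^ A.card • genProd A := by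
  rw [genProd_eq, hat, CliffordAlgebra.involute_prod_map_ι, List.length_ofFn]

/-- The index type is not literally `Fin 2`, so the facts are obtained by generalizing `n % 2`. -/
theorem two_blocks {n : ℕ} (h : Odd n) (f : Fin (n % 2 + 1) → ℂ) :
    ∑ i, f i = f 0 + f (Fin.last _) ∧ Fin.last (n % 2) ≠ 0 ∧
      ∀ i : Fin (n % 2 + 1), i = 0 ∨ i = Fin.last _ := by
  have h := Nat.odd_iff.1 h
  generalize n % 2 = k at *
  subst h
  exact ⟨Fin.sum_univ_two f, by decide, by decide⟩

section Block

variable {m K : Type*} [Fintype m] [DecidableEq m] [Fintype K] [DecidableEq K]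

/-- The block-diagonal representation with given blocks. -/
noncomputable def blockHom (Ψ : Cl p q →ₐ[ℝ] (K → Matrix m m ℂ)) :
    Cl p q →ₐ[ℝ] Matrix (m × K) (m × K) ℂ :=
  AlgHom.mk' ((Matrix.blockDiagonalRingHom m K ℂ).comp (Ψ : Cl p q →+* _)) fun c x => by
    simp only [RingHom.comp_apply, RingHom.coe_coe, map_smul]
    exact Matrix.blockDiagonal_smul c _

theorem blockHom_apply (Ψ : Cl p q →ₐ[ℝ] (K → Matrix m m ℂ)) (x : Cl p q) :
    blockHom Ψ x = Matrix.blockDiagonal (Ψ x) := rfl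

/-- Distinct basis elements are orthogonal for the trace form. -/
theorem scalarPart_genProd_mul_genProd {ι : Type*} [Fintype ι] [DecidableEq ι] [Nonempty ι]
    (ρ : Cl p q →ₐ[ℝ] Matrix ι ι ℂ)
    (hω : Odd (p + q) → (ρ (genProd Finset.univ)).trace = 0) {A B : Finset (Fin (p + q))}
    (hAB : A ≠ B) : scalarPart p q (genProd A * genProd B) = 0 := by
  rcases Nat.even_or_odd (A.card + B.card) with he | ho
  -- An index in exactly one of `A`, `B` gives a generator anticommuting with the product. For odd
  -- total degree the grade involution does the job instead.
  · obtain ⟨a, ha⟩ : ∃ a, Odd ((if a ∈ A then 1 else 0) + if a ∈ B then 1 else 0) := by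
      by_contra! hne
      refine hAB (Finset.ext fun a => ?_)
      have := hne a
      by_cases h1 : a ∈ A <;> by_cases h2 : a ∈ B <;> simp [h1, h2] at this ⊢
    have hc : (gen a * (genProd A * genProd B) : Cl p q) = -(genProd A * genProd B * gen a) := by
      have hodd : Odd ((A.card + if a ∈ A then 1 else 0) + (B.card + if a ∈ B then 1 else 0)) := by
        rw [add_add_add_comm]; exact he.add_odd ha
      rw [mul_assoc (genProd A), genProd_mul_gen B, mul_smul_comm, ← mul_assoc (genProd A),
        genProd_mul_gen A, smul_mul_assoc, smul_smul, ← pow_add,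
        add_comm (B.card + _), hodd.neg_one_pow, neg_one_smul, neg_neg, mul_assoc]
    have := trace_eq_zero_of_anticomm ρ a hc
    rw [trace_eq_scalarPart ρ hω] at this
    simpa using this
  · have h : hat (genProd A * genProd B : Cl p q) = -(genProd A * genProd B) := by
      rw [hat_mul, hat_genProd, hat_genProd, smul_mul_smul_comm, ← pow_add, ho.neg_one_pow,
        neg_one_smul]
    have h' := congrArg (fun y => (bladeBasis p q).repr y ∅) h
    simp only [repr_hat, Finset.card_empty, pow_zero, one_mul, map_neg, Finsupp.neg_apply] at h'
    rw [scalarPart, Module.Basis.coord_apply]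
    linarith

/-- The complexification of a representation with vanishing traces is injective. -/
theorem lift_injective [Nonempty m] [Nonempty K] (Ψ : Cl p q →ₐ[ℝ] (K → Matrix m m ℂ))
    (hω : Odd (p + q) → (blockHom Ψ (genProd Finset.univ)).trace = 0)
    (Φ : (ℂ ⊗[ℝ] Cl p q) →ₐ[ℂ] (K → Matrix m m ℂ)) (hΦ : ∀ x, Φ (1 ⊗ₜ x) = Ψ x) :
    Function.Injective Φ := by
  rw [injective_iff_map_eq_zero]
  intro z hz
  set b := (bladeBasis p q).baseChange ℂ with hb
  refine b.ext_elem fun A => ?_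
  rw [map_zero, Finsupp.zero_apply]
  obtain ⟨c, hc, hA⟩ := exists_genProd_mul_self A
  -- By orthogonality this trace is a nonzero multiple of the coefficient of `z` at `A`.
  have h : (Matrix.blockDiagonal (Φ (z * 1 ⊗ₜ genProd A))).trace = 0 := by
    rw [map_mul, hz, zero_mul, Matrix.blockDiagonal_zero, Matrix.trace_zero]
  have hs : z * 1 ⊗ₜ genProd A = ∑ B, b.repr z B • ((1 : ℂ) ⊗ₜ[ℝ] (genProd B * genProd A)) := by
    conv_lhs => rw [← b.sum_repr z, Finset.sum_mul]
    refine Finset.sum_congr rfl fun B _ => ?_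
    rw [hb, Module.Basis.baseChange_apply, bladeBasis_apply, smul_mul_assoc,
      Algebra.TensorProduct.tmul_mul_tmul, one_mul]
  have ht (x : Cl p q) : (Matrix.blockDiagonal (Ψ x)).trace =
      Fintype.card (m × K) * (scalarPart p q x : ℂ) := trace_eq_scalarPart (blockHom Ψ) hω x
  have hlin : (Matrix.blockDiagonal (Φ (z * 1 ⊗ₜ genProd A))).trace =
      ∑ B, b.repr z B * (Fintype.card (m × K) * (scalarPart p q (genProd B * genProd A) : ℂ)) := by
    rw [hs, map_sum, ← Matrix.blockDiagonalRingHom_apply, map_sum, Matrix.trace_sum]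
    refine Finset.sum_congr rfl fun B _ => ?_
    rw [map_smul, hΦ, Matrix.blockDiagonalRingHom_apply, Matrix.blockDiagonal_smul,
      Matrix.trace_smul, ht, smul_eq_mul]
  rw [hlin, Finset.sum_eq_single A, hA, map_smul, scalarPart_one] at h
  · simpa [hc] using h
  · intro B _ hB
    rw [scalarPart_genProd_mul_genProd (blockHom Ψ) hω hB]
    simp
  · simp

end Block

/-- The universal property of the Clifford algebra, in terms of the generators. -/
theorem exists_algHom_gen {T : Type*} [Ring T] [Algebra ℝ T] (E : Fin (p + q) → T)
    (h : ∀ a b, E a * E b + E b * E a =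
      if a = b then (2 * if (a : ℕ) < p then (1 : ℝ) else -1) • 1 else 0) :
    Nonempty (Cl p q →ₐ[ℝ] T) := by
  refine ⟨CliffordAlgebra.lift (sigForm p q) ⟨Fintype.linearCombination ℝ E, fun v => ?_⟩⟩
  rw [Fintype.linearCombination_apply, Algebra.algebraMap_eq_smul_one]
  set y := ∑ a, v a • E a with hy
  have e : y * y = ∑ a, ∑ b, (v a * v b) • (E a * E b) := by
    rw [hy, Finset.sum_mul_sum]
    simp only [smul_mul_smul_comm]
  have e' : y * y + y * y = ∑ a, ∑ b, (v a * v b) • (E a * E b + E b * E a) := by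
    simp only [smul_add, Finset.sum_add_distrib]
    rw [← e]
    congr 1
    rw [e, Finset.sum_comm]
    simp only [mul_comm]
  simp only [h, smul_ite, smul_zero, Finset.sum_ite_eq, Finset.mem_univ, if_true, smul_smul,
    ← Finset.sum_smul] at e'
  rw [← two_smul ℝ] at e'
  refine smul_right_injective T (two_ne_zero (α := ℝ)) (e'.trans ?_)
  simp only [smul_smul]
  congr 1
  rw [sigForm, QuadraticMap.weightedSumSquares_apply, Finset.mul_sum]
  refine Finset.sum_congr rfl fun a _ => ?_
  rw [smul_eq_mul]
  ring

/-- `n` pairwise anticommuting complex matrices of size `d` with square `1`. -/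
def HasGammaMatrices (n d : ℕ) : Prop :=
  ∃ M : Fin n → Matrix (Fin d) (Fin d) ℂ,
    ∀ a b, M a * M b + M b * M a = if a = b then (2 : ℂ) • 1 else 0

theorem HasGammaMatrices.restrict {n d : ℕ} (h : HasGammaMatrices (n + 1) d) :
    HasGammaMatrices n d := by
  obtain ⟨M, hM⟩ := h
  exact ⟨fun a => M a.castSucc, fun a b => by simp [hM]⟩

/-- The old matrices are placed off the diagonal, where they anticommute with the new `diag(1, -1)`.
-/
theorem HasGammaMatrices.double {n d : ℕ} (h : HasGammaMatrices n d) :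
    HasGammaMatrices (n + 1) (d + d) := by
  obtain ⟨M, hM⟩ := h
  let r := Matrix.reindexAlgEquiv ℂ ℂ (finSumFinEquiv (m := d) (n := d))
  refine ⟨Fin.snoc (fun a => r (Matrix.fromBlocks 0 (M a) (M a) 0))
    (r (Matrix.fromBlocks 1 0 0 (-1))), fun a b => ?_⟩
  have h2 : (2 : ℂ) • (1 : Matrix (Fin (d + d)) (Fin (d + d)) ℂ) =
      r (Matrix.fromBlocks ((2 : ℂ) • 1) 0 0 ((2 : ℂ) • 1)) := by
    rw [← map_one r, ← map_smul, ← Matrix.fromBlocks_one, Matrix.fromBlocks_smul, smul_zero]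
  induction a using Fin.lastCases with
  | last =>
    induction b using Fin.lastCases with
    | last =>
      rw [if_pos rfl, h2]
      simp only [Fin.snoc_last, ← map_mul, ← map_add, Matrix.fromBlocks_multiply,
        Matrix.fromBlocks_add]
      congr 2 <;> simp [two_smul]
    | cast b =>
      rw [if_neg (Fin.castSucc_lt_last b).ne']
      simp only [Fin.snoc_last, Fin.snoc_castSucc, ← map_mul, ← map_add,
        Matrix.fromBlocks_multiply, Matrix.fromBlocks_add]
      simp
  | cast a =>
    induction b using Fin.lastCases with
    | last =>
      rw [if_neg (Fin.castSucc_lt_last a).ne]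
      simp only [Fin.snoc_last, Fin.snoc_castSucc, ← map_mul, ← map_add,
        Matrix.fromBlocks_multiply, Matrix.fromBlocks_add]
      simp
    | cast b =>
      simp only [Fin.snoc_castSucc, ← map_mul, ← map_add, Matrix.fromBlocks_multiply,
        Matrix.fromBlocks_add, Fin.castSucc_inj, h2]
      simp only [zero_mul, mul_zero, add_zero, zero_add, hM]
      split_ifs <;> simp

theorem hasGammaMatrices_one : HasGammaMatrices 1 1 :=
  ⟨fun _ => 1, fun a b => by rw [Subsingleton.elim a b, if_pos rfl, mul_one, two_smul]⟩

/-- The Pauli matrices. -/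
theorem hasGammaMatrices_three : HasGammaMatrices 3 2 := by
  refine ⟨![!![0, 1; 1, 0], !![0, -Complex.I; Complex.I, 0], !![1, 0; 0, -1]], fun a b => ?_⟩
  fin_cases a <;> fin_cases b <;> ext i j <;> fin_cases i <;> fin_cases j <;>
    norm_num [Matrix.mul_apply, Fin.sum_univ_two]

theorem hasGammaMatrices {n : ℕ} (h1 : 1 ≤ n) (h4 : n ≤ 4) : HasGammaMatrices n (2 ^ (n / 2)) := by
  interval_cases n
  · exact hasGammaMatrices_one
  · exact hasGammaMatrices_three.restrict
  · exact hasGammaMatrices_three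
  · exact hasGammaMatrices_three.double

theorem HasGammaMatrices.nonempty_algHom {d : ℕ} (h : HasGammaMatrices (p + q) d) :
    Nonempty (Cl p q →ₐ[ℝ] Matrix (Fin d) (Fin d) ℂ) := by
  obtain ⟨M, hM⟩ := h
  -- The factor `i` turns square `1` into square `-1` for the negative directions.
  refine exists_algHom_gen (fun a => (if (a : ℕ) < p then (1 : ℂ) else Complex.I) • M a)
    fun a b => ?_
  rw [smul_mul_smul_comm, smul_mul_smul_comm, mul_comm (ite _ _ _) (ite ((a : ℕ) < p) _ _),
    ← smul_add, hM]
  by_cases hab : a = b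
  · subst hab
    rw [if_pos rfl, if_pos rfl, smul_smul, ← Complex.coe_smul]
    congr 1
    split_ifs <;> simp
  · rw [if_neg hab, if_neg hab, smul_zero]

/-- For odd `n` the second block is twisted by the grade involution, which makes the top product
traceless. The trace form then gives injectivity, and equality of dimensions gives bijectivity. -/
theorem nonempty_rep (h1 : 1 ≤ p + q) (h4 : p + q ≤ 4) : Nonempty (Rep p q) := by
  obtain ⟨Ψ₀⟩ := (hasGammaMatrices h1 h4).nonempty_algHom
  let Ψ : Cl p q →ₐ[ℝ] (Fin ((p + q) % 2 + 1) →
      Matrix (Fin (2 ^ ((p + q) / 2))) (Fin (2 ^ ((p + q) / 2))) ℂ) :=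
    AlgHom.pi fun i => if i = 0 then Ψ₀ else Ψ₀.comp CliffordAlgebra.involute
  let Φ := Algebra.TensorProduct.lift (Algebra.ofId ℂ _) Ψ fun x _ => Algebra.commutes x _
  have hΦ (x : Cl p q) : Φ (1 ⊗ₜ x) = Ψ x := by
    refine (Algebra.TensorProduct.lift_tmul _ _ _ _ _).trans ?_
    rw [map_one, one_mul]
  have hinj : Function.Injective Φ := by
    refine lift_injective Ψ (fun hodd => ?_) Φ hΦ
    rw [blockHom_apply, Matrix.trace_blockDiagonal]
    obtain ⟨hsum, hne, -⟩ := two_blocks hodd fun i => (Ψ (genProd Finset.univ) i).trace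
    have h0 : Ψ (genProd Finset.univ) 0 = Ψ₀ (genProd Finset.univ) := by simp [Ψ]
    have h1 : Ψ (genProd Finset.univ) (Fin.last _) = Ψ₀ (hat (genProd Finset.univ)) := by
      simp only [Ψ, AlgHom.pi_apply, if_neg hne]
      rfl
    rw [hsum, h0, h1, hat_genProd, Finset.card_univ, Fintype.card_fin, hodd.neg_one_pow,
      neg_one_smul, map_neg, Matrix.trace_neg, add_neg_cancel]
  have hfin : Module.finrank ℂ (ℂ ⊗[ℝ] Cl p q) = Module.finrank ℂ (Fin ((p + q) % 2 + 1) →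
      Matrix (Fin (2 ^ ((p + q) / 2))) (Fin (2 ^ ((p + q) / 2))) ℂ) := by
    rw [Module.finrank_baseChange, Module.finrank_eq_card_basis (bladeBasis p q),
      Module.finrank_pi_fintype]
    simp only [Module.finrank_matrix, Fintype.card_finset, Fintype.card_fin, Finset.sum_const,
      Finset.card_univ, Module.finrank_self]
    generalize p + q = n at h1 h4
    interval_cases n <;> norm_num
  have : Module.Finite ℝ (Cl p q) := .of_basis (bladeBasis p q)
  exact ⟨AlgEquiv.ofBijective Φ ⟨hinj, (LinearMap.injective_iff_surjective_of_finrank_eq_finrank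
    (f := Φ.toLinearMap) hfin).1 hinj⟩⟩

/-! ### Traces and adjugates for an arbitrary representation. -/

/-- The representation `U ↦ β(U)` of the real algebra. -/
noncomputable def repHom (β : Rep p q) :=
  blockHom ((β.toAlgHom.restrictScalars ℝ).comp
    (Algebra.TensorProduct.includeRight : Cl p q →ₐ[ℝ] ℂ ⊗[ℝ] Cl p q))

theorem repHom_apply (β : Rep p q) (U : Cl p q) : repHom β U = repMatrix β U := rfl

theorem repMatrix_injective (β : Rep p q) : Function.Injective (repMatrix β) := fun _ _ h =>
  Algebra.TensorProduct.includeRight_injective (R := ℝ) (A := ℂ) (B := Cl p q)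
    (algebraMap ℝ ℂ).injective (β.injective (Matrix.blockDiagonal_injective h))

/-- The image of the central top product is a scalar in each block, and the two scalars have the
same square. If they were equal, injectivity of `β` would make the top product a scalar; so they are
opposite. -/
theorem trace_repHom_genProd_univ (β : Rep p q) (hodd : Odd (p + q)) :
    (repHom β (genProd Finset.univ)).trace = 0 := by
  set ω : Cl p q := genProd Finset.univ with hω
  set Z := β (1 ⊗ₜ ω) with hZ
  have hcent (T) : T * Z = Z * T := by
    obtain ⟨x, rfl⟩ := β.surjective T
    rw [hZ, ← map_mul, ← map_mul]
    congr 1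
    induction x with
    | zero => simp
    | add x y hx hy => rw [add_mul, mul_add, hx, hy]
    | tmul z x =>
      rw [Algebra.TensorProduct.tmul_mul_tmul, Algebra.TensorProduct.tmul_mul_tmul, mul_one,
        one_mul, hω, genProd_univ_commute hodd]
  have hscal (i) : Z i ∈ Set.range (Matrix.scalar (Fin (2 ^ ((p + q) / 2)))) := by
    -- Surjectivity of `β` makes `Z` commute with matrix units supported in one block.
    refine Matrix.mem_range_scalar_iff_commute_single'.2 fun j k => ?_
    have := congrFun (hcent (Pi.single i (Matrix.single j k 1))) i
    rw [Pi.mul_apply, Pi.mul_apply, Pi.single_eq_same] at this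
    exact this
  choose z hz using hscal
  obtain ⟨c, -, hc⟩ := exists_genProd_mul_self (p := p) (q := q) Finset.univ
  have hsq (i) : z i * z i = c := by
    have h : Z * Z = (c : ℂ) • 1 := by
      rw [hZ, ← map_mul, Algebra.TensorProduct.tmul_mul_tmul, one_mul, hω, hc,
        ← TensorProduct.smul_tmul, Complex.real_smul, ← smul_eq_mul, ← TensorProduct.smul_tmul',
        map_smul, ← Algebra.TensorProduct.one_def, map_one]
    have h' := congrFun (congrFun (congrFun h i) 0) 0
    rw [Pi.mul_apply, ← hz, ← map_mul] at h'
    simpa using h'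
  obtain ⟨hsum, hne, hall⟩ := two_blocks hodd fun i => (Z i).trace
  have hz0 : z 0 ≠ z (Fin.last _) := by
    intro he
    have hZ' : Z = β (z 0 • 1) := by
      rw [map_smul, map_one]
      funext i
      have hi : z i = z 0 := by
        rcases hall i with rfl | rfl
        · rfl
        · exact he.symm
      rw [← hz, hi]
      ext j k
      by_cases h : j = k <;> simp [h]
    have h := congrArg (fun y => ((bladeBasis p q).baseChange ℂ).repr y Finset.univ)
      (β.injective hZ')
    have h1 : (1 : ℂ ⊗[ℝ] Cl p q) = (bladeBasis p q).baseChange ℂ ∅ := by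
      rw [Module.Basis.baseChange_apply, bladeBasis_apply, genProd_empty]; rfl
    have h2 : (1 : ℂ) ⊗ₜ[ℝ] ω = (bladeBasis p q).baseChange ℂ Finset.univ := by
      rw [Module.Basis.baseChange_apply, bladeBasis_apply]
    have h3 : (∅ : Finset (Fin (p + q))) ≠ Finset.univ := fun h => by
      have := congrArg Finset.card h
      rw [Finset.card_empty, Finset.card_univ, Fintype.card_fin] at this
      rw [← this] at hodd
      exact absurd hodd (by decide)
    simp only [h2, h1, map_smul, Module.Basis.repr_self, Finsupp.smul_apply,
      Finsupp.single_eq_same, Finsupp.single_apply, if_neg h3, smul_zero] at h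
    exact one_ne_zero h
  have hopp : z 0 + z (Fin.last _) = 0 := by
    have : (z 0 - z (Fin.last _)) * (z 0 + z (Fin.last _)) = 0 := by
      linear_combination hsq 0 - hsq (Fin.last _)
    exact (mul_eq_zero.1 this).resolve_left (sub_ne_zero.2 hz0)
  have htr (i) : (Z i).trace = 2 ^ ((p + q) / 2) * z i := by
    rw [← hz, Matrix.scalar_apply, Matrix.trace_diagonal]
    simp
  have : (repHom β ω).trace = ∑ i, (Z i).trace := by
    rw [repHom, blockHom_apply, Matrix.trace_blockDiagonal]; rfl
  rw [this, hsum, htr, htr, ← mul_add, hopp, mul_zero]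

theorem card_repIndex (p q : ℕ) :
    Fintype.card (Fin (2 ^ ((p + q) / 2)) × Fin ((p + q) % 2 + 1)) = repDim p q := by
  rw [Fintype.card_prod, Fintype.card_fin, Fintype.card_fin, repDim]
  rcases Nat.even_or_odd (p + q) with h | h
  · rw [Nat.even_iff.1 h, show (p + q + 1) / 2 = (p + q) / 2 by rcases h with ⟨k, hk⟩; omega,
      zero_add, mul_one]
  · rw [Nat.odd_iff.1 h, show (p + q + 1) / 2 = (p + q) / 2 + 1 by rcases h with ⟨k, hk⟩; omega,
      pow_succ]

theorem trace_repHom (β : Rep p q) (x : Cl p q) :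
    (repHom β x).trace = Fintype.card (Fin (2 ^ ((p + q) / 2)) × Fin ((p + q) % 2 + 1)) *
      (scalarPart p q x : ℂ) :=
  trace_eq_scalarPart _ (trace_repHom_genProd_univ β) x

/-- Injectivity of `repMatrix β` pulls the matrix adjugate identities back to the real algebra and
gives uniqueness. -/
theorem adjAndInverse_of_adjugate {β : Rep p q} {U F : Cl p q}
    (hdet : (repMatrix β U).det = (Det β U : ℂ))
    (hadj : (repMatrix β U).adjugate = repMatrix β F) : AdjAndInverse β U F := by
  have hD : repMatrix β (algebraMap ℝ (Cl p q) (Det β U)) = (repMatrix β U).det • 1 := by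
    rw [hdet, Algebra.algebraMap_eq_smul_one]
    exact (repHom β).map_smul_one_eq _
  have hl : F * U = algebraMap ℝ (Cl p q) (Det β U) := repMatrix_injective β <| by
    rw [hD, ← Matrix.adjugate_mul, hadj]
    exact map_mul (repHom β) F U
  have hr : U * F = algebraMap ℝ (Cl p q) (Det β U) := repMatrix_injective β <| by
    rw [hD, ← Matrix.mul_adjugate, hadj]
    exact map_mul (repHom β) U F
  have hinv (h : Det β U ≠ 0) : ∃ u : (Cl p q)ˣ, (u : Cl p q) = U ∧
      ((u⁻¹ : (Cl p q)ˣ) : Cl p q) = (Det β U)⁻¹ • F := by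
    refine ⟨⟨U, (Det β U)⁻¹ • F, ?_, ?_⟩, rfl, rfl⟩
    · rw [mul_smul_comm, hr, Algebra.algebraMap_eq_smul_one, smul_smul, inv_mul_cancel₀ h, one_smul]
    · rw [smul_mul_assoc, hl, Algebra.algebraMap_eq_smul_one, smul_smul, inv_mul_cancel₀ h,
        one_smul]
  refine ⟨fun V => ⟨fun hV => repMatrix_injective β (hV.2.2.trans hadj), ?_⟩, ⟨fun hU h => ?_,
    fun h => ?_⟩, fun h => ?_⟩
  · rintro rfl
    exact ⟨hl, hr, hadj.symm⟩
  · have := (Matrix.isUnit_iff_isUnit_det _).1 (hU.map (repHom β))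
    rw [repHom_apply, hdet, h] at this
    simp at this
  · obtain ⟨u, hu, -⟩ := hinv h
    exact ⟨u, hu⟩
  · obtain ⟨u, hu, hu'⟩ := hinv h
    rw [← hu', ← hu, Ring.inverse_unit]

/-! ### Coefficients and the explicit formulas. -/

theorem det_eq_coeff_zero (β : Rep p q) (U : Cl p q) (h : Even (repDim p q)) :
    (repMatrix β U).det = (repMatrix β U).charpoly.coeff 0 := by
  rw [Matrix.det_eq_sign_charpoly_coeff, card_repIndex, h.neg_one_pow, one_mul]

theorem charPoly_quadratic {β : Rep p q} {U : Cl p q} {c₁ c₂ : ℝ} (hN : repDim p q = 2)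
    (h : (repMatrix β U).charpoly = .X ^ 2 - .C (c₁ : ℂ) * .X + .C (c₂ : ℂ)) :
    CharPolyIsReal β U ∧ charCoeff β 1 U = c₁ ∧ charCoeff β 2 U = -c₂ ∧ Det β U = c₂ := by
  have hdet := det_eq_coeff_zero β U (by rw [hN]; decide)
  have e : Det β U = c₂ := by rw [Det, hdet, h]; simp
  have e₁ : charCoeff β 1 U = c₁ := by
    rw [charCoeff, hN, h]; simp [Polynomial.coeff_C]
  have e₂ : charCoeff β 2 U = -c₂ := by
    rw [charCoeff, hN, h]; simp
  refine ⟨⟨by rw [e, hdet, h]; simp, ?_⟩, e₁, e₂, e⟩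
  rw [hN, h, show Finset.Icc 1 2 = {1, 2} by decide, Finset.sum_pair (by decide), e₁, e₂]
  simp
  ring

theorem charPoly_quartic {β : Rep p q} {U : Cl p q} {c₁ c₂ c₃ c₄ : ℝ} (hN : repDim p q = 4)
    (h : (repMatrix β U).charpoly = .X ^ 4 - .C (c₁ : ℂ) * .X ^ 3 + .C (c₂ : ℂ) * .X ^ 2
      - .C (c₃ : ℂ) * .X + .C (c₄ : ℂ)) :
    CharPolyIsReal β U ∧ charCoeff β 1 U = c₁ ∧ charCoeff β 2 U = -c₂ ∧ charCoeff β 3 U = c₃ ∧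
      charCoeff β 4 U = -c₄ ∧ Det β U = c₄ := by
  have hdet := det_eq_coeff_zero β U (by rw [hN]; decide)
  have e : Det β U = c₄ := by rw [Det, hdet, h]; simp
  have e₁ : charCoeff β 1 U = c₁ := by
    rw [charCoeff, hN, h]
    simp [Polynomial.coeff_X_pow]
  have e₂ : charCoeff β 2 U = -c₂ := by
    rw [charCoeff, hN, h]
    simp [Polynomial.coeff_X_pow]
  have e₃ : charCoeff β 3 U = c₃ := by
    rw [charCoeff, hN, h]
    simp [Polynomial.coeff_C, Polynomial.coeff_X_pow]
  have e₄ : charCoeff β 4 U = -c₄ := by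
    rw [charCoeff, hN, h]; simp
  refine ⟨⟨by rw [e, hdet, h]; simp, ?_⟩, e₁, e₂, e₃, e₄, e⟩
  rw [hN, h, show Finset.Icc 1 4 = {1, 2, 3, 4} by decide]
  simp [e₁, e₂, e₃, e₄]
  ring

theorem charPoly_of_le_two (h1 : 1 ≤ p + q) (h2 : p + q ≤ 2) (β : Rep p q) (U : Cl p q) :
    CharPolyIsReal β U ∧
      algebraMap ℝ (Cl p q) (charCoeff β 1 U) = U + hat (tilde U) ∧
      algebraMap ℝ (Cl p q) (Det β U) = U * hat (tilde U) ∧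
      Det β U = -charCoeff β 2 U ∧
      AdjAndInverse β U (hat (tilde U)) := by
  have hN : repDim p q = 2 := by
    rw [repDim, show (p + q + 1) / 2 = 1 by omega, pow_one]
  rw [← cliffordConj_apply]
  have hT := eq_smul_one_of_cliffordConj_eq h2 (x := U + cliffordConj p q U)
    (by rw [map_add, cliffordConj_cliffordConj, add_comm])
  have hH := eq_smul_one_of_cliffordConj_eq h2 (x := U * cliffordConj p q U)
    (by rw [cliffordConj_mul, cliffordConj_cliffordConj])
  obtain ⟨hch, hadj⟩ := charpoly_and_adjugate_of_quadratic (repHom β) (scalarPart p q)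
    scalarPart_one (trace_repHom β) ((card_repIndex p q).trans hN) hT hH
    (by rw [map_add, scalarPart_cliffordConj, two_mul])
  obtain ⟨hreal, e₁, e₂, e⟩ := charPoly_quadratic hN hch
  refine ⟨hreal, ?_, ?_, by rw [e, e₂, neg_neg], adjAndInverse_of_adjugate hreal.1 hadj⟩
  · rw [e₁, Algebra.algebraMap_eq_smul_one, ← hT]
  · rw [e, Algebra.algebraMap_eq_smul_one, ← hH]

/-- Keeping `T` and `H` as parameters lets each dimension insert its own form of the quadratic
conjugate. -/
theorem charPoly_of_three_le (h3 : 3 ≤ p + q) (h4 : p + q ≤ 4) (β : Rep p q) {U T H : Cl p q}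
    (hT : T = (2 * scalarPart p q (U + hat (tilde U))) • 1 - (U + hat (tilde U)))
    (hH : H = (2 * scalarPart p q (U * hat (tilde U))) • 1 - U * hat (tilde U)) :
    CharPolyIsReal β U ∧
      algebraMap ℝ (Cl p q) (charCoeff β 1 U) = U + hat (tilde U) + T ∧
      algebraMap ℝ (Cl p q) (charCoeff β 2 U) =
        -((U + hat (tilde U)) * T + U * hat (tilde U) + H) ∧
      algebraMap ℝ (Cl p q) (charCoeff β 3 U) =
        (U + hat (tilde U)) * H + U * hat (tilde U) * T ∧
      algebraMap ℝ (Cl p q) (Det β U) = U * hat (tilde U) * H ∧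
      Det β U = -charCoeff β 4 U ∧
      AdjAndInverse β U (hat (tilde U) * H) := by
  have hN : repDim p q = 4 := by
    rw [repDim, show (p + q + 1) / 2 = 2 by omega]; norm_num
  rw [← cliffordConj_apply] at *
  obtain ⟨c₁, c₂, c₃, c₄, h₁, h₂, h₃, h₄, hch, hadj⟩ := exists_charpoly_and_adjugate (repHom β)
    (scalarPart p q) scalarPart_one (trace_repHom β) ((card_repIndex p q).trans hN)
    (cliffordConj p q) cliffordConj_mul cliffordConj_cliffordConj scalarPart_cliffordConj
    (fun _ => exists_sq_eq_of_cliffordConj_eq h4) hT hH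
  obtain ⟨hreal, e₁, e₂, e₃, e₄, e⟩ := charPoly_quartic hN hch
  refine ⟨hreal, ?_, ?_, ?_, ?_, by rw [e, e₄, neg_neg], adjAndInverse_of_adjugate hreal.1 hadj⟩
  · rw [e₁, Algebra.algebraMap_eq_smul_one, ← h₁]
  · rw [e₂, Algebra.algebraMap_eq_smul_one, neg_smul, ← h₂]
  · rw [e₃, Algebra.algebraMap_eq_smul_one, ← h₃]
  · rw [e, Algebra.algebraMap_eq_smul_one, ← h₄]

theorem cliffordConj_fixed (U : Cl p q) :
    cliffordConj p q (U + hat (tilde U)) = U + hat (tilde U) ∧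
      cliffordConj p q (U * hat (tilde U)) = U * hat (tilde U) := by
  rw [← cliffordConj_apply]
  exact ⟨by rw [map_add, cliffordConj_cliffordConj, add_comm],
    by rw [cliffordConj_mul, cliffordConj_cliffordConj]⟩

theorem tilde_eq_self (h1 : p + q ≤ 1) (U : Cl p q) : tilde U = U := by
  refine (bladeBasis p q).ext_elem fun A => ?_
  have := card_le_sum A
  rw [repr_tilde, Nat.choose_eq_zero_of_lt (by omega), pow_zero, one_mul]

/-- Here `T = hat U + tilde U` and `H = hat U * tilde U` are central, which permits the reordering
of factors in the stated formulas. -/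
theorem charPoly_of_three (h3 : p + q = 3) (β : Rep p q) (U : Cl p q) :
    CharPolyIsReal β U ∧
      algebraMap ℝ (Cl p q) (charCoeff β 1 U) = U + hat U + tilde U + hat (tilde U) ∧
        algebraMap ℝ (Cl p q) (charCoeff β 2 U) =
          -(U * tilde U + U * hat U + U * hat (tilde U) + hat U * hat (tilde U)
            + tilde U * hat (tilde U) + hat U * tilde U) ∧
        algebraMap ℝ (Cl p q) (charCoeff β 3 U) =
          U * hat U * hat (tilde U) + U * tilde U * hat (tilde U) + U * hat U * tilde U
            + hat U * tilde U * hat (tilde U) ∧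
        algebraMap ℝ (Cl p q) (Det β U) = U * hat U * tilde U * hat (tilde U) ∧
        Det β U = -charCoeff β 4 U ∧
        AdjAndInverse β U (hat U * tilde U * hat (tilde U)) := by
  obtain ⟨hfT, hfH⟩ := cliffordConj_fixed U
  have hT := hat_eq_of_cliffordConj_eq h3.le hfT
  have hH := hat_eq_of_cliffordConj_eq h3.le hfH
  rw [hat_add, hat_hat] at hT
  rw [hat_mul, hat_hat] at hH
  have hsharp {x : Cl p q} (hx : cliffordConj p q x = x) (c : ℝ) (y : Cl p q) :
      (c • 1 - x) * y = y * (c • 1 - x) := by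
    rw [sub_mul, mul_sub, commute_of_cliffordConj_eq h3 hx y, smul_mul_assoc, mul_smul_comm,
      one_mul, mul_one]
  have hcT (y : Cl p q) : (hat U + tilde U) * y = y * (hat U + tilde U) := by
    rw [hT]; exact hsharp hfT _ y
  have hcH (y : Cl p q) : hat U * tilde U * y = y * (hat U * tilde U) := by
    rw [hH]; exact hsharp hfH _ y
  obtain ⟨hreal, e₁, e₂, e₃, e, e', hadj⟩ := charPoly_of_three_le h3.ge (by omega) β hT hH
  refine ⟨hreal, e₁.trans (by abel), e₂.trans ?_, e₃.trans ?_, e.trans ?_, e', ?_⟩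
  · rw [add_mul, ← hcT (hat (tilde U))]
    noncomm_ring
  · rw [add_mul, ← hcH (hat (tilde U)), mul_assoc U, ← hcT (hat (tilde U))]
    noncomm_ring
  · rw [mul_assoc U, ← hcH (hat (tilde U))]
    simp only [mul_assoc]
  · rwa [hcH]

/-- Here `T = tri (hat U) + tri (tilde U)` and `H = tri (hat U * tilde U)`; the factors already
stand in the required order, so no commutation is used. -/
theorem charPoly_of_four (h4 : p + q = 4) (β : Rep p q) (U : Cl p q) :
    CharPolyIsReal β U ∧
      algebraMap ℝ (Cl p q) (charCoeff β 1 U) =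
          U + hat (tilde U) + tri (hat U) + tri (tilde U) ∧
        algebraMap ℝ (Cl p q) (charCoeff β 2 U) =
          -(U * hat (tilde U) + U * tri (hat U) + U * tri (tilde U)
            + hat (tilde U) * tri (hat U) + hat (tilde U) * tri (tilde U)
            + tri (hat U * tilde U)) ∧
        algebraMap ℝ (Cl p q) (charCoeff β 3 U) =
          U * hat (tilde U) * tri (hat U) + U * hat (tilde U) * tri (tilde U)
            + U * tri (hat U * tilde U) + hat (tilde U) * tri (hat U * tilde U) ∧
        algebraMap ℝ (Cl p q) (Det β U) = U * hat (tilde U) * tri (hat U * tilde U) ∧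
        Det β U = -charCoeff β 4 U ∧
        AdjAndInverse β U (hat (tilde U) * tri (hat U * tilde U)) := by
  obtain ⟨hfT, hfH⟩ := cliffordConj_fixed U
  have hT := tri_hat_eq_of_cliffordConj_eq h4.le hfT
  have hH := tri_hat_eq_of_cliffordConj_eq h4.le hfH
  rw [hat_add, hat_hat, tri_add] at hT
  rw [hat_mul, hat_hat] at hH
  obtain ⟨hreal, e₁, e₂, e₃, e, e', hadj⟩ := charPoly_of_three_le (by omega) h4.le β hT hH
  refine ⟨hreal, e₁.trans (by abel), e₂.trans ?_, e₃.trans ?_, e, e', hadj⟩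
  · rw [add_mul, mul_add, mul_add]; abel
  · rw [add_mul, mul_add]; abel

end GeomAlg

theorem mainTheorem4 (p q : ℕ) (h1 : 1 ≤ p + q) (h4 : p + q ≤ 4) :
    Nonempty (Rep p q) ∧
    ∀ (β : Rep p q) (U : Cl p q),
      CharPolyIsReal β U ∧
      (p + q = 1 →
        algebraMap ℝ (Cl p q) (charCoeff β 1 U) = U + hat U ∧
        algebraMap ℝ (Cl p q) (Det β U) = U * hat U ∧
        Det β U = -charCoeff β 2 U ∧
        AdjAndInverse β U (hat U)) ∧
      (p + q = 2 →
        algebraMap ℝ (Cl p q) (charCoeff β 1 U) = U + hat (tilde U) ∧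
        algebraMap ℝ (Cl p q) (Det β U) = U * hat (tilde U) ∧
        Det β U = -charCoeff β 2 U ∧
        AdjAndInverse β U (hat (tilde U))) ∧
      (p + q = 3 →
        algebraMap ℝ (Cl p q) (charCoeff β 1 U) = U + hat U + tilde U + hat (tilde U) ∧
        algebraMap ℝ (Cl p q) (charCoeff β 2 U) =
          -(U * tilde U + U * hat U + U * hat (tilde U) + hat U * hat (tilde U)
            + tilde U * hat (tilde U) + hat U * tilde U) ∧
        algebraMap ℝ (Cl p q) (charCoeff β 3 U) =
          U * hat U * hat (tilde U) + U * tilde U * hat (tilde U) + U * hat U * tilde U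
            + hat U * tilde U * hat (tilde U) ∧
        algebraMap ℝ (Cl p q) (Det β U) = U * hat U * tilde U * hat (tilde U) ∧
        Det β U = -charCoeff β 4 U ∧
        AdjAndInverse β U (hat U * tilde U * hat (tilde U))) ∧
      (p + q = 4 →
        algebraMap ℝ (Cl p q) (charCoeff β 1 U) =
          U + hat (tilde U) + tri (hat U) + tri (tilde U) ∧
        algebraMap ℝ (Cl p q) (charCoeff β 2 U) =
          -(U * hat (tilde U) + U * tri (hat U) + U * tri (tilde U)
            + hat (tilde U) * tri (hat U) + hat (tilde U) * tri (tilde U)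
            + tri (hat U * tilde U)) ∧
        algebraMap ℝ (Cl p q) (charCoeff β 3 U) =
          U * hat (tilde U) * tri (hat U) + U * hat (tilde U) * tri (tilde U)
            + U * tri (hat U * tilde U) + hat (tilde U) * tri (hat U * tilde U) ∧
        algebraMap ℝ (Cl p q) (Det β U) = U * hat (tilde U) * tri (hat U * tilde U) ∧
        Det β U = -charCoeff β 4 U ∧
        AdjAndInverse β U (hat (tilde U) * tri (hat U * tilde U))) := by
  refine ⟨nonempty_rep h1 h4, fun β U => ?_⟩
  obtain h | h | h : p + q ≤ 2 ∨ p + q = 3 ∨ p + q = 4 := by omega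
  · obtain ⟨hreal, hrest⟩ := charPoly_of_le_two h1 h β U
    refine ⟨hreal, fun h' => ?_, fun _ => hrest, fun _ => by omega, fun _ => by omega⟩
    -- For `n = 1` reversion is trivial, so the formulas of `n = 2` specialize.
    rwa [tilde_eq_self h'.le] at hrest
  · obtain ⟨hreal, hrest⟩ := charPoly_of_three h β U
    exact ⟨hreal, fun _ => by omega, fun _ => by omega, fun _ => hrest, fun _ => by omega⟩
  · obtain ⟨hreal, hrest⟩ := charPoly_of_four h β U
    exact ⟨hreal, fun _ => by omega, fun _ => by omega, fun _ => by omega, fun _ => hrest⟩
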